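/- Let $\mathbb{F}_2^\infty=\bigcup_n \mathbb{F}_2^n$ be the $\mathbb{F}_2$-vector space of finitely supported sequences over $\mathbb{F}_2$. A finite non-empty subset $A$ of an abelian group is a *$K$-approximate group* if $-A=A$ and $A+A$ is covered by at most $K$ translates of $A$. For finite sets $A,B$, we say that $B$ *$K$-controls* $A$ if $|B|\le K|A|$ and there is a set $X$ with $|X|\le K$ and $A\subseteq B+X$. For a finite abelian group $G$ and $f:G\to\mathbb{C}$, the Gowers norm $\|f\|_{U^3(G)}\geq 0$ is given by $$\|f\|_{U^3(G)}^8=\mathbb{E}_{x,h_1,h_2,h_3\in G}\, f(x)\overline{f(x+h_1)f(x+h_2)f(x+h_3)}\,f(x+h_1+h_2)f(x+h_1+h_3)f(x+h_2+h_3)\,\overline{f(x+h_1+h_2+h_3)},$$ and $f$ is a *$K$-approximate quadratic* if $|f(x)|\le 1$ for all $x \in G$ and $\|f\|_{U^3(G)}\ge 1/K$. A map $\psi:\mathbb{F}_2^n\to\mathbb{F}_2$ is a *quadratic polynomial* if $\Delta_{h_1}\Delta_{h_2}\Delta_{h_3}\psi(x)=0$ for all $x,h_1,h_2,h_3\in\mathbb{F}_2^n$,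 where $\Delta_h\psi(x)=\psi(x+h)-\psi(x)$. **Theorem.** The following two statements are equivalent. 1. (Polynomial Freiman–Ruzsa conjecture over $\mathbb{F}_2^\infty$.) There is an absolute constant $C>0$ such that for every real $K\ge 2$, every $K$-approximate group $A\subseteq\mathbb{F}_2^\infty$ is $K^C$-controlled by a finite subgroup of $\mathbb{F}_2^\infty$. 2. (Polynomial inverse conjecture for the $U^3$ norm over $\mathbb{F}_2^n$.) There is an absolute constant $C>0$ such that for every real $K\ge 2$, every integer $n\ge 0$ and every $K$-approximate quadratic $f:\mathbb{F}_2^n\to\mathbb{C}$, there is a quadratic polynomial $\psi:\mathbb{F}_2^n\to\mathbb{F}_2$ with $$\bigl|\mathbb{E}_{x\in\mathbb{F}_2^n} f(x)(-1)^{\psi(x)}\bigr|\ge K^{-C}.$$ -/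

import Mathlib

open scoped BigOperators Pointwise ComplexConjugate

noncomputable section

/-- `A` is a `K`-approximate group: a finite non-empty symmetric set whose sumset `A + A`
is covered by at most `K` translates of `A`. (The set `A` need not contain `0`.) -/
structure IsApproxGroup {G : Type*} [AddCommGroup G] (K : ℝ) (A : Set G) : Prop where
  finite : A.Finite
  nonempty : A.Nonempty
  neg_mem : ∀ x ∈ A, -x ∈ A
  covered : ∃ X : Finset G, (X.card : ℝ) ≤ K ∧ A + A ⊆ (X : Set G) + A

/-- `B` `K`-controls `A` (for finite sets `A`, `B`): `|B| ≤ K |A|`, and `A ⊆ B + X` for some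
set `X` with `|X| ≤ K`. -/
def Controls {G : Type*} [AddCommGroup G] (K : ℝ) (B A : Set G) : Prop :=
  A.Finite ∧ B.Finite ∧ (B.ncard : ℝ) ≤ K * (A.ncard : ℝ) ∧
    ∃ X : Finset G, (X.card : ℝ) ≤ K ∧ A ⊆ B + (X : Set G)

/-- The average over all parallelepipeds that defines the eighth power of the `U³` norm. -/
def gowersU3Average {G : Type*} [AddCommGroup G] [Fintype G] (f : G → ℂ) : ℂ :=
  𝔼 x : G, 𝔼 h₁ : G, 𝔼 h₂ : G, 𝔼 h₃ : G,
    f x * conj (f (x + h₁)) * conj (f (x + h₂)) * conj (f (x + h₃)) *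
      f (x + h₁ + h₂) * f (x + h₁ + h₃) * f (x + h₂ + h₃) * conj (f (x + h₁ + h₂ + h₃))

/-- The average in the `U³` norm is an average of squared moduli; in particular it is a
non-negative real number, so that taking its real part below loses nothing. -/
theorem gowersU3Average_eq {G : Type*} [AddCommGroup G] [Fintype G] (f : G → ℂ) :
    gowersU3Average f =
      ((𝔼 h₁ : G, 𝔼 h₂ : G, ‖𝔼 x : G,
        f x * conj (f (x + h₁)) * conj (f (x + h₂)) * f (x + h₁ + h₂)‖ ^ 2 : ℝ) : ℂ) := by
  have key : ∀ h₁ h₂ : G, ((‖𝔼 x : G,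
        f x * conj (f (x + h₁)) * conj (f (x + h₂)) * f (x + h₁ + h₂)‖ ^ 2 : ℝ) : ℂ) =
      𝔼 x : G, 𝔼 h₃ : G,
    f x * conj (f (x + h₁)) * conj (f (x + h₂)) * conj (f (x + h₃)) *
      f (x + h₁ + h₂) * f (x + h₁ + h₃) * f (x + h₂ + h₃) * conj (f (x + h₁ + h₂ + h₃)) := by
    intro h₁ h₂
    rw [Complex.ofReal_pow, ← Complex.mul_conj', map_expect, Finset.expect_mul]
    refine Finset.expect_congr rfl fun x _ => ?_
    rw [Finset.mul_expect]
    refine (Fintype.expect_equiv (Equiv.addLeft x) _ _ fun h₃ => ?_).symm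
    simp only [Equiv.coe_addLeft, map_mul, Complex.conj_conj]
    rw [show x + h₁ + h₃ = x + h₃ + h₁ by abel, show x + h₂ + h₃ = x + h₃ + h₂ by abel,
      show x + h₁ + h₂ + h₃ = x + h₃ + h₁ + h₂ by abel]
    ring
  rw [gowersU3Average, Finset.expect_comm]
  push_cast [Complex.ofReal_expect] at key ⊢
  refine Finset.expect_congr rfl fun h₁ _ => ?_
  rw [Finset.expect_comm]
  exact Finset.expect_congr rfl fun h₂ _ => (key h₁ h₂).symm

/-- The Gowers norm `‖f‖_{U³(G)}`. -/
def gowersU3Norm {G : Type*} [AddCommGroup G] [Fintype G] (f : G → ℂ) : ℝ :=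
  (gowersU3Average f).re ^ (1 / 8 : ℝ)

/-- `f` is a `K`-approximate quadratic: `‖f‖_∞ ≤ 1` and `‖f‖_{U³} ≥ 1 / K`. -/
def IsApproxQuadratic {G : Type*} [AddCommGroup G] [Fintype G] (K : ℝ) (f : G → ℂ) : Prop :=
  (∀ x, ‖f x‖ ≤ 1) ∧ 1 / K ≤ gowersU3Norm f

/-- `ψ` is a quadratic polynomial: `Δ_{h₁} Δ_{h₂} Δ_{h₃} ψ = 0` for all `h₁, h₂, h₃`, where
`fwdDiff h ψ x = ψ (x + h) - ψ x`. -/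
def IsQuadraticPolynomial {G H : Type*} [AddCommGroup G] [AddCommGroup H] (ψ : G → H) : Prop :=
  ∀ h₁ h₂ h₃ x : G, fwdDiff h₁ (fwdDiff h₂ (fwdDiff h₃ ψ)) x = 0

/-- The phase `(-1)^ψ`. -/
def signPhase {G : Type*} (ψ : G → ZMod 2) : G → ℂ :=
  fun x => (-1 : ℂ) ^ (ψ x).val

/-- `f` `δ`-correlates with `F`: the inner product `𝔼_x f(x) conj(F(x))` is at least `δ` in
modulus. -/
def Correlates {G : Type*} [Fintype G] (δ : ℝ) (f F : G → ℂ) : Prop :=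
  δ ≤ ‖𝔼 x : G, f x * conj (F x)‖

end

/-! Both directions trade a quadratic phase for the linear behaviour of its derivatives, and all
losses are powers of `K`.

Freiman–Ruzsa implies inverse theorem. If `‖f‖_{U³}` is large, many multiplicative derivatives `x ↦
f(x) conj(f(x + h))` have large `U²` norm, hence a large Fourier coefficient at some frequency `ξ
h`. Gowers' Cauchy–Schwarz argument (`sum_norm_sq_hat_pow_four_le`) shows that the graph of `ξ` has
large additive energy. `balog_szemeredi_gowers` extracts a piece of small doubling, the
Freiman–Ruzsa hypothesis places much of it in a coset of a small subgroup, and so `ξ` agrees with an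
affine map `h ↦ M h + η` on a dense set (`exists_linearMap_of_graphOver`). It remains to integrate
`M`. The bilinear form `B(h, k) = M h · k` must be nearly symmetric (`card_ker_ge_of_boxSum`), and
in characteristic 2 a further subspace of index at most 2 makes it alternating. An alternating form
is the polarisation of a quadratic `q`. Replacing `B` by an alternating form costs boundedly many
linear twists, and absorbing `q` into the functions reduces the claim to the `U²` inverse theorem
(`exists_quadratic_of_sum_norm_sq_hat`).

Inverse theorem implies Freiman–Ruzsa. A set `A` of small doubling is mapped by a linear `π`,
faithfully on sums of four elements, to a dense subset `E` of some `𝔽₂ᵐ` (`exists_small_model`).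
With `φ` the inverse of `π` on `E`, the function `1_E(x) (-1)^{φ(x) · y}` has the same `U³` norm as
`1_E`, so it correlates with a quadratic phase. The bilinear part `L x · y` of that phase must agree
with `φ(x) · y` up to a constant frequency for many `x`, so a large part of `A` lies in a coset of
the range of `L`; Ruzsa covering then handles all of `A`. -/

/-- The vector space `𝔽₂ⁿ`. -/
abbrev F2 (n : ℕ) := Fin n → ZMod 2

/-! ### Fourier analysis on `𝔽₂ⁿ` and the `U²` norm. -/

/-- The sign character of `𝔽₂`. -/
noncomputable def sgn (a : ZMod 2) : ℂ := (-1 : ℂ) ^ a.val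

@[simp] lemma sgn_zero : sgn 0 = 1 := by simp [sgn]

lemma sgn_one : sgn 1 = -1 := by simp [sgn, ZMod.val_one]

lemma sgn_add (a b : ZMod 2) : sgn (a + b) = sgn a * sgn b := by
  have h : (1 + 1 : ZMod 2) = 0 := by decide
  have h2 : ∀ c : ZMod 2, c = 0 ∨ c = 1 := by decide
  rcases h2 a with rfl | rfl <;> rcases h2 b with rfl | rfl <;> simp [sgn_one, h]

@[simp] lemma conj_sgn (a : ZMod 2) : conj (sgn a) = sgn a := by simp [sgn]

@[simp] lemma norm_sgn (a : ZMod 2) : ‖sgn a‖ = 1 := by simp [sgn]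

lemma sgn_mul_self (a : ZMod 2) : sgn a * sgn a = 1 := by
  rw [← sgn_add, CharTwo.add_self_eq_zero, sgn_zero]

lemma card_F2_pos (n : ℕ) : (0 : ℝ) < Fintype.card (F2 n) := by
  exact_mod_cast Fintype.card_pos

/-- Orthogonality of the characters of `𝔽₂ⁿ`. -/
lemma sum_sgn_dotProduct {n : ℕ} (x : F2 n) :
    ∑ ξ : F2 n, sgn (ξ ⬝ᵥ x) = if x = 0 then (Fintype.card (F2 n) : ℂ) else 0 := by
  split_ifs with hx
  · simp [hx]
  · obtain ⟨i, hi⟩ : ∃ i, x i ≠ 0 := by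
      by_contra! h
      exact hx (funext h)
    have hi1 : x i = 1 := by
      generalize x i = a at hi
      revert hi; revert a; decide
    have h := Equiv.sum_comp (Equiv.addRight (Pi.single i 1 : F2 n)) (fun ξ => sgn (ξ ⬝ᵥ x))
    simp only [Equiv.coe_addRight, add_dotProduct, sgn_add, single_one_dotProduct, hi1,
      sgn_one] at h
    rw [← Finset.sum_mul] at h
    linear_combination (-1 / 2 : ℂ) * h

/-- The unnormalised Fourier transform on `𝔽₂ⁿ`. -/
noncomputable def hat {n : ℕ} (g : F2 n → ℂ) (ξ : F2 n) : ℂ := ∑ x, g x * sgn (ξ ⬝ᵥ x)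

lemma norm_sq_eq_mul_conj (z : ℂ) : ((‖z‖ ^ 2 : ℝ) : ℂ) = z * conj z := by
  rw [Complex.mul_conj', Complex.ofReal_pow]

lemma sum_norm_sq_hat {n : ℕ} (g : F2 n → ℂ) :
    ∑ ξ, ‖hat g ξ‖ ^ 2 = Fintype.card (F2 n) * ∑ x, ‖g x‖ ^ 2 := by
  have key : ∑ ξ, hat g ξ * conj (hat g ξ) =
      ∑ x, ∑ y, g x * conj (g y) * ∑ ξ : F2 n, sgn (ξ ⬝ᵥ (x + y)) := by
    simp only [hat, map_sum, Finset.sum_mul_sum]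
    simp only [Finset.mul_sum]
    rw [Finset.sum_comm]
    refine Finset.sum_congr rfl fun x _ => ?_
    rw [Finset.sum_comm]
    refine Finset.sum_congr rfl fun y _ => Finset.sum_congr rfl fun ξ _ => ?_
    rw [dotProduct_add, sgn_add, map_mul, conj_sgn]
    ring
  have h2 : ∀ x y : F2 n, x + y = 0 ↔ x = y := fun x y => by
    rw [← ZModModule.sub_eq_add, sub_eq_zero]
  simp only [sum_sgn_dotProduct, h2, mul_ite, mul_zero, Finset.sum_ite_eq, Finset.mem_univ,
    if_true] at key
  have : ((∑ ξ, ‖hat g ξ‖ ^ 2 : ℝ) : ℂ) =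
      ((Fintype.card (F2 n) * ∑ x, ‖g x‖ ^ 2 : ℝ) : ℂ) := by
    push_cast only [Complex.ofReal_sum, Complex.ofReal_mul, norm_sq_eq_mul_conj]
    rw [key, ← Finset.sum_mul, mul_comm]
    simp
  exact_mod_cast this

/-- The correlation `k ↦ ∑ₓ a(x) b(x + k)`. -/
noncomputable def corr {n : ℕ} (a b : F2 n → ℂ) (k : F2 n) : ℂ := ∑ x, a x * b (x + k)

lemma hat_corr {n : ℕ} (a b : F2 n → ℂ) (ξ : F2 n) :
    hat (corr a b) ξ = hat a ξ * hat b ξ := by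
  simp only [hat, corr, Finset.sum_mul]
  rw [Finset.sum_comm]
  refine Finset.sum_congr rfl fun x _ => ?_
  rw [← Equiv.sum_comp (Equiv.addLeft x) (fun y => b y * _), Finset.mul_sum]
  refine Finset.sum_congr rfl fun y _ => ?_
  simp only [Equiv.coe_addLeft, dotProduct_add, sgn_add]
  linear_combination (-a x * b (x + y) * sgn (ξ ⬝ᵥ y)) * sgn_mul_self (ξ ⬝ᵥ x)

/-- The Fourier transform turns a correlation into a product, so Plancherel lets the supremum of one
factor be pulled out. -/
lemma sum_norm_sq_corr_le {n : ℕ} {a : F2 n → ℂ} (b : F2 n → ℂ) {B : ℝ}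
    (hB : ∀ ξ, ‖hat a ξ‖ ^ 2 ≤ B) : ∑ k, ‖corr a b k‖ ^ 2 ≤ B * ∑ x, ‖b x‖ ^ 2 := by
  refine le_of_mul_le_mul_left ?_ (card_F2_pos n)
  rw [← sum_norm_sq_hat]
  calc ∑ ξ, ‖hat (corr a b) ξ‖ ^ 2 ≤ ∑ ξ, B * ‖hat b ξ‖ ^ 2 := by
        refine Finset.sum_le_sum fun ξ _ => ?_
        rw [hat_corr, norm_mul, mul_pow]
        exact mul_le_mul_of_nonneg_right (hB ξ) (by positivity)
    _ = _ := by rw [← Finset.mul_sum, sum_norm_sq_hat]; ring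

lemma sum_norm_sq_le_card {n : ℕ} {g : F2 n → ℂ} (hg : ∀ x, ‖g x‖ ≤ 1) :
    ∑ x, ‖g x‖ ^ 2 ≤ Fintype.card (F2 n) := by
  refine (Finset.sum_le_card_nsmul _ _ 1 fun x _ => ?_).trans (by simp)
  exact pow_le_one₀ (norm_nonneg _) (hg x)

/-- The unnormalised fourth power of the `U²` norm. -/
noncomputable def gowersU2Sum {n : ℕ} (g : F2 n → ℂ) : ℝ :=
  ∑ k, ‖corr g (fun x => conj (g x)) k‖ ^ 2

/-- The inverse theorem for `U²`: the sum is essentially the `ℓ⁴` norm of the transform, which is at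
most its largest value squared times the `L²` mass. -/
lemma exists_gowersU2Sum_le {n : ℕ} {g : F2 n → ℂ} (hg : ∀ x, ‖g x‖ ≤ 1) :
    ∃ ξ, gowersU2Sum g ≤ Fintype.card (F2 n) * ‖hat g ξ‖ ^ 2 := by
  obtain ⟨ξ, -, hξ⟩ := Finset.exists_max_image Finset.univ (fun ξ => ‖hat g ξ‖ ^ 2) ⟨0, by simp⟩
  refine ⟨ξ, (sum_norm_sq_corr_le _ fun ζ => hξ ζ (Finset.mem_univ _)).trans ?_⟩
  rw [mul_comm]
  gcongr
  exact sum_norm_sq_le_card (by simpa using hg)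

lemma norm_sq_sum_mul_le {ι : Type*} [Fintype ι] {a : ι → ℂ} (ha : ∀ x, ‖a x‖ ≤ 1) (b : ι → ℂ) :
    ‖∑ x, a x * b x‖ ^ 2 ≤ Fintype.card ι * ∑ x, ‖b x‖ ^ 2 := by
  calc ‖∑ x, a x * b x‖ ^ 2 ≤ (∑ x, ‖b x‖) ^ 2 := by
        gcongr
        refine (norm_sum_le _ _).trans (Finset.sum_le_sum fun x _ => ?_)
        rw [norm_mul]
        exact mul_le_of_le_one_left (norm_nonneg _) (ha x)
    _ ≤ _ := sq_sum_le_card_mul_sum_sq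

lemma norm_sum_le_card {ι : Type*} [Fintype ι] {a : ι → ℂ} (ha : ∀ x, ‖a x‖ ≤ 1) :
    ‖∑ x, a x‖ ≤ Fintype.card ι := by
  refine (norm_sum_le _ _).trans ?_
  refine (Finset.sum_le_card_nsmul _ _ 1 fun x _ => ha x).trans (by simp)

/-- Two applications of Cauchy–Schwarz. The first removes `a`; expanding the square pairs `h` with
`h + t` and gives a sum over `t` of autocorrelations of `b` and `g`. The second removes the
autocorrelation of `b`, which is at most the size of the group. -/
lemma norm_sum_pow_four_le_gowersU2Sum {n : ℕ} {a b : F2 n → ℂ} (ha : ∀ x, ‖a x‖ ≤ 1)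
    (hb : ∀ x, ‖b x‖ ≤ 1) (g : F2 n → ℂ) :
    ‖∑ x, ∑ h, a x * (g h * b (x + h))‖ ^ 4 ≤
      (Fintype.card (F2 n) : ℝ) ^ 5 * gowersU2Sum g := by
  set N : ℝ := (Fintype.card (F2 n) : ℝ)
  have hN : 0 < N := card_F2_pos n
  have h1 : ‖∑ x, ∑ h, a x * (g h * b (x + h))‖ ^ 2 ≤ N * ∑ x, ‖∑ h, g h * b (x + h)‖ ^ 2 := by
    simp only [← Finset.mul_sum]
    exact norm_sq_sum_mul_le ha _
  have h2 : ((∑ x, ‖∑ h, g h * b (x + h)‖ ^ 2 : ℝ) : ℂ) =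
      ∑ t, corr b (fun x => conj (b x)) t * corr g (fun x => conj (g x)) t := by
    push_cast only [Complex.ofReal_sum, norm_sq_eq_mul_conj]
    simp only [corr, map_sum, Finset.sum_mul_sum]
    have e1 : ∀ x h : F2 n, ∑ j, g h * b (x + h) * conj (g j * b (x + j)) =
        ∑ t, g h * b (x + h) * conj (g (h + t) * b (x + h + t)) := fun x h => by
      rw [← Equiv.sum_comp (Equiv.addLeft h)]
      simp [add_assoc]
    simp only [e1]
    calc _ = ∑ h, ∑ x, ∑ t, g h * b (x + h) * conj (g (h + t) * b (x + h + t)) :=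
          Finset.sum_comm
      _ = ∑ h, ∑ x, ∑ t, g h * b x * conj (g (h + t) * b (x + t)) := by
          refine Finset.sum_congr rfl fun h _ => ?_
          rw [← Equiv.sum_comp (Equiv.addRight h) (fun x =>
            ∑ t, g h * b x * conj (g (h + t) * b (x + t)))]
          rfl
      _ = ∑ x, ∑ h, ∑ t, g h * b x * conj (g (h + t) * b (x + t)) := Finset.sum_comm
      _ = ∑ x, ∑ t, ∑ h, g h * b x * conj (g (h + t) * b (x + t)) :=
          Finset.sum_congr rfl fun x _ => Finset.sum_comm
      _ = _ := by
          rw [Finset.sum_comm]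
          refine Finset.sum_congr rfl fun x _ => Finset.sum_congr rfl fun y _ =>
            Finset.sum_congr rfl fun h _ => ?_
          simp only [map_mul]
          ring
  have h3 : (∑ x, ‖∑ h, g h * b (x + h)‖ ^ 2) ^ 2 ≤ N ^ 3 * gowersU2Sum g := by
    have h4 : (∑ x, ‖∑ h, g h * b (x + h)‖ ^ 2) =
        ‖∑ t, corr b (fun x => conj (b x)) t * corr g (fun x => conj (g x)) t‖ := by
      rw [← h2, Complex.norm_real, Real.norm_of_nonneg (by positivity)]
    have h5 : ∀ t, ‖corr b (fun x => conj (b x)) t / N‖ ≤ 1 := fun t => by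
      rw [norm_div, Complex.norm_real, Real.norm_of_nonneg hN.le, div_le_one hN]
      refine norm_sum_le_card fun x => ?_
      rw [norm_mul]
      exact mul_le_one₀ (hb _) (norm_nonneg _) (by simpa using hb _)
    have h6 := norm_sq_sum_mul_le h5 (fun t => corr g (fun x => conj (g x)) t)
    have h7 : ∑ t, corr b (fun x => conj (b x)) t * corr g (fun x => conj (g x)) t =
        N * ∑ t, corr b (fun x => conj (b x)) t / N * corr g (fun x => conj (g x)) t := by
      rw [Finset.mul_sum]
      refine Finset.sum_congr rfl fun t _ => ?_
      have : (N : ℂ) ≠ 0 := by exact_mod_cast hN.ne'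
      field_simp
    rw [h4, h7, norm_mul, mul_pow, Complex.norm_real, Real.norm_of_nonneg hN.le]
    calc _ ≤ N ^ 2 * (N * gowersU2Sum g) := by gcongr; exact h6
      _ = _ := by ring
  calc _ = (‖∑ x, ∑ h, a x * (g h * b (x + h))‖ ^ 2) ^ 2 := by ring
    _ ≤ (N * ∑ x, ‖∑ h, g h * b (x + h)‖ ^ 2) ^ 2 := by gcongr
    _ = N ^ 2 * (∑ x, ‖∑ h, g h * b (x + h)‖ ^ 2) ^ 2 := by ring
    _ ≤ N ^ 2 * (N ^ 3 * gowersU2Sum g) := by gcongr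
    _ = _ := by ring

/-! ### The Balog–Szemerédi–Gowers theorem. -/

section BSG

variable {Z : Type*} [AddCommGroup Z] [DecidableEq Z]

/-- The set of `a ∈ A` with `a + z ∈ A`. -/
def popularFiber (A : Finset Z) (z : Z) : Finset Z := A.filter fun a => a + z ∈ A

/-- Through each common partner `c`, write `a - b = (c - b) - (c - a)` and expand both differences
inside `A`. Every `d ∈ D` thus comes from at least `m / 2 * ε ^ 2` quadruples of `A`, and different
`d` use different quadruples. -/
lemma card_mul_pow_le_of_popular {A : Finset Z} {m : ℕ} {ε : ℝ} (hε : 0 ≤ ε) {D : Finset Z}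
    (hD : ∀ d ∈ D, ∃ a b : Z, a - b = d ∧ ∃ C : Finset Z, m ≤ 2 * C.card ∧ ∀ c ∈ C,
      ε ≤ (popularFiber A (c - a)).card ∧ ε ≤ (popularFiber A (c - b)).card) :
    (D.card : ℝ) * (m / 2 * ε ^ 2) ≤ (A.card : ℝ) ^ 4 := by
  classical
  set Q : Finset ((Z × Z) × (Z × Z)) := (A ×ˢ A) ×ˢ (A ×ˢ A)
  let F : (Z × Z) × (Z × Z) → Z := fun q => (q.2.2 - q.2.1) - (q.1.2 - q.1.1)
  have hfib : ∀ d ∈ D, (m / 2 * ε ^ 2 : ℝ) ≤ ((Q.filter fun q => F q = d).card : ℝ) := by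
    intro d hd
    obtain ⟨a, b, rfl, C, hC, hpop⟩ := hD d hd
    let T : Finset (Σ _ : Z, Z × Z) :=
      C.sigma fun c => popularFiber A (c - a) ×ˢ popularFiber A (c - b)
    have hT : T.card ≤ (Q.filter fun q => F q = a - b).card := by
      refine Finset.card_le_card_of_injOn
        (fun t => ((t.2.1, t.2.1 + (t.1 - a)), (t.2.2, t.2.2 + (t.1 - b)))) ?_ ?_
      · rintro ⟨c, u, v⟩ h
        simp only [T, Finset.coe_sigma, Set.mem_sigma_iff, Finset.mem_coe, Finset.mem_product,
          popularFiber, Finset.mem_filter] at h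
        simp only [Q, F, Finset.coe_filter, Finset.mem_product, Set.mem_ofPred_eq]
        refine ⟨⟨⟨h.2.1.1, h.2.1.2⟩, h.2.2.1, h.2.2.2⟩, by abel⟩
      · rintro ⟨c, u, v⟩ - ⟨c', u', v'⟩ - h
        simp only [Prod.mk.injEq] at h
        obtain ⟨⟨rfl, h1⟩, rfl, h2⟩ := h
        simp only [add_right_inj, sub_left_inj] at h1
        subst h1; rfl
    refine le_trans ?_ (Nat.cast_le.2 hT)
    simp only [T, Finset.card_sigma, Finset.card_product]
    push_cast
    calc (m / 2 * ε ^ 2 : ℝ) ≤ C.card * ε ^ 2 := by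
          gcongr
          rw [div_le_iff₀ (by norm_num), mul_comm]
          exact_mod_cast hC
      _ = ∑ _c ∈ C, ε ^ 2 := by simp
      _ ≤ _ := by
          refine Finset.sum_le_sum fun c hc => ?_
          rw [sq]
          exact mul_le_mul (hpop c hc).1 (hpop c hc).2 hε (by positivity)
  calc (D.card : ℝ) * (m / 2 * ε ^ 2) = ∑ _d ∈ D, (m / 2 * ε ^ 2 : ℝ) := by simp
    _ ≤ ∑ d ∈ D, ((Q.filter fun q => F q = d).card : ℝ) := Finset.sum_le_sum hfib
    _ = (((Q.filter fun q => F q ∈ D).card : ℕ) : ℝ) := by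
        rw [Finset.card_eq_sum_card_fiberwise (f := F) (t := D)
          (fun q hq => by simpa using (Finset.mem_filter.1 hq).2)]
        push_cast
        refine Finset.sum_congr rfl fun d hd => ?_
        congr 2
        ext q
        simp only [Finset.mem_filter]
        constructor
        · rintro ⟨h1, h2⟩; exact ⟨⟨h1, h2 ▸ hd⟩, h2⟩
        · rintro ⟨⟨h1, -⟩, h2⟩; exact ⟨h1, h2⟩
    _ ≤ (Q.card : ℝ) := by exact_mod_cast Finset.card_filter_le _ _
    _ = (A.card : ℝ) ^ 4 := by simp only [Q, Finset.card_product]; push_cast; ring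

variable [Fintype Z]

lemma sum_card_popularFiber (A : Finset Z) :
    ∑ z, (popularFiber A z).card = A.card ^ 2 := by
  simp only [popularFiber, Finset.card_filter]
  rw [Finset.sum_comm]
  have : ∀ a : Z, ∑ z, (if a + z ∈ A then 1 else 0) = A.card := fun a => by
    refine (Equiv.sum_comp (Equiv.addLeft a) (fun z => if z ∈ A then 1 else 0)).trans ?_
    simp
  simp [this, sq]

/-- The pairs in `popularFiber A x` whose difference is not popular. -/
noncomputable def badPairs (A : Finset Z) (ε : ℝ) (x : Z) : Finset (Z × Z) :=
  (popularFiber A x ×ˢ popularFiber A x).filter fun p =>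
    ((popularFiber A (p.2 - p.1)).card : ℝ) < ε

/-- Double counting: the number of `x` for which a pair lies in the square of `popularFiber A x` is
the popularity of its difference, which is below `ε` for a bad pair. -/
lemma sum_card_badPairs_le (A : Finset Z) {ε : ℝ} (hε : 0 ≤ ε) :
    ∑ x, ((badPairs A ε x).card : ℝ) ≤ ε * (A.card : ℝ) ^ 2 := by
  have h1 : ∀ x, badPairs A ε x = ((A ×ˢ A).filter fun p =>
      ((popularFiber A (p.2 - p.1)).card : ℝ) < ε).filter
        fun p => p.1 + x ∈ A ∧ p.2 + x ∈ A := by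
    intro x
    ext p
    have hm : ∀ a, a ∈ popularFiber A x ↔ a ∈ A ∧ a + x ∈ A := fun a => Finset.mem_filter
    simp only [badPairs, Finset.mem_filter, Finset.mem_product, hm]
    tauto
  have h2 : ∀ p : Z × Z, ∑ x, (if p.1 + x ∈ A ∧ p.2 + x ∈ A then 1 else 0 : ℝ) =
      (popularFiber A (p.2 - p.1)).card := fun p => by
    rw [← Equiv.sum_comp (Equiv.subRight p.1)]
    simp only [Equiv.subRight_apply, add_sub_cancel, popularFiber, Finset.card_filter]
    push_cast
    rw [← Finset.sum_subset (Finset.subset_univ A)]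
    · refine Finset.sum_congr rfl fun a ha => ?_
      simp only [ha, true_and]
      rw [show p.2 + (a - p.1) = a + (p.2 - p.1) by abel]
    · intro a _ ha
      simp [ha]
  calc ∑ x, ((badPairs A ε x).card : ℝ)
      = ∑ p ∈ (A ×ˢ A).filter fun p => ((popularFiber A (p.2 - p.1)).card : ℝ) < ε,
        ((popularFiber A (p.2 - p.1)).card : ℝ) := by
        simp only [h1, Finset.card_filter _ (Finset.filter _ _)]
        push_cast
        rw [Finset.sum_comm]
        exact Finset.sum_congr rfl fun p _ => h2 p
    _ ≤ ∑ p ∈ (A ×ˢ A).filter fun p => ((popularFiber A (p.2 - p.1)).card : ℝ) < ε, ε :=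
        Finset.sum_le_sum fun p hp => (Finset.mem_filter.1 hp).2.le
    _ ≤ ∑ p ∈ A ×ˢ A, ε := Finset.sum_le_sum_of_subset_of_nonneg (Finset.filter_subset _ _)
        fun _ _ _ => hε
    _ = _ := by simp [Finset.card_product]; ring

/-- The Balog–Szemerédi–Gowers theorem. -/
theorem balog_szemeredi_gowers (A : Finset Z) {N κ : ℝ} (hN : 0 < N) (hκ : 0 < κ)
    (hA : (A.card : ℝ) ≤ N) (hE : κ * N ^ 3 ≤ ∑ z, ((popularFiber A z).card : ℝ) ^ 2) :
    ∃ A' ⊆ A, 3 / 8 * κ * N ≤ A'.card ∧ ((A' - A').card : ℝ) ≤ 4356 / κ ^ 3 * N := by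
  classical
  -- The choice 33 makes `1/2 + 16/33 < 1`, which contradicts the energy bound if no `x` is
  -- suitable; it later yields `4356 = 4 * 33 ^ 2`.
  set ε : ℝ := κ * N / 33 with hε
  have hε0 : 0 < ε := by positivity
  obtain ⟨x, hx1, hx2⟩ : ∃ x, κ * N / 2 ≤ (popularFiber A x).card ∧
      ((badPairs A ε x).card : ℝ) ≤ 1 / 16 * ((popularFiber A x).card : ℝ) ^ 2 := by
    by_contra! hcon
    have hle : ∀ x, ((popularFiber A x).card : ℝ) ^ 2 ≤
        κ * N / 2 * (popularFiber A x).card + 16 * (badPairs A ε x).card := fun x => by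
      by_cases hx : κ * N / 2 ≤ (popularFiber A x).card
      · have := hcon x hx
        have : 0 ≤ κ * N / 2 * (popularFiber A x).card := by positivity
        linarith
      · have : ((popularFiber A x).card : ℝ) ^ 2 ≤ κ * N / 2 * (popularFiber A x).card := by
          rw [sq]
          gcongr
          exact (not_le.1 hx).le
        have : (0 : ℝ) ≤ (badPairs A ε x).card := by positivity
        linarith
    have h1 := hE.trans (Finset.sum_le_sum fun x _ => hle x)
    rw [Finset.sum_add_distrib, ← Finset.mul_sum, ← Finset.mul_sum] at h1
    have h2 := sum_card_badPairs_le A hε0.le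
    have h3 : ∑ x, ((popularFiber A x).card : ℝ) = (A.card : ℝ) ^ 2 := by
      exact_mod_cast sum_card_popularFiber A
    rw [h3] at h1
    have h4 : (A.card : ℝ) ^ 2 ≤ N ^ 2 := by gcongr
    have h5 : κ * N / 2 * (A.card : ℝ) ^ 2 ≤ κ * N / 2 * N ^ 2 := by gcongr
    have h6 : ε * (A.card : ℝ) ^ 2 ≤ κ * N / 33 * N ^ 2 := by rw [hε]; gcongr
    have h7 : 0 < κ * N ^ 3 := by positivity
    nlinarith
  set S := popularFiber A x
  let bad : Z → Finset Z := fun a =>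
    S.filter fun b => ((popularFiber A (b - a)).card : ℝ) < ε
  -- Bad pairs number at most a sixteenth of `|S| ^ 2`, so at most a quarter of `S` has more than
  -- `|S| / 4` bad partners. Any two survivors share at least half of `S` as good partners.
  set A' := S.filter fun a => 4 * (bad a).card ≤ S.card
  have hSA : S ⊆ A := Finset.filter_subset _ _
  have hS0 : (0 : ℝ) < S.card := lt_of_lt_of_le (by positivity) hx1
  have hbad : (badPairs A ε x).card = ∑ a ∈ S, (bad a).card := by
    simp only [badPairs, bad, Finset.card_filter, Finset.sum_product]
    rfl
  have hA' : 3 / 4 * (S.card : ℝ) ≤ A'.card := by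
    have h1 : (S.card : ℝ) * (S.card - A'.card) ≤ 4 * (badPairs A ε x).card := by
      have h2 : ∑ a ∈ S.filter (fun a => ¬ 4 * (bad a).card ≤ S.card), (S.card : ℝ) ≤
          ∑ a ∈ S, (4 * (bad a).card : ℝ) := by
        refine (Finset.sum_le_sum fun a ha => ?_).trans
          (Finset.sum_le_sum_of_subset_of_nonneg (Finset.filter_subset _ _)
            fun _ _ _ => by positivity)
        have := (Finset.mem_filter.1 ha).2
        push Not at this
        exact_mod_cast this.le
      rw [Finset.sum_const, nsmul_eq_mul, ← Finset.mul_sum] at h2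
      have h3 : (A'.card : ℝ) +
          ((S.filter (fun a => ¬ 4 * (bad a).card ≤ S.card)).card : ℝ) = S.card := by
        exact_mod_cast Finset.card_filter_add_card_filter_not (s := S) _
      rw [hbad]
      push_cast
      calc _ = _ := by rw [← h3]; ring_nf
        _ ≤ _ := h2
    nlinarith
  refine ⟨A', (Finset.filter_subset _ _).trans hSA, by linarith, ?_⟩
  have hmain := card_mul_pow_le_of_popular (A := A) (m := S.card) (D := A' - A')
    hε0.le ?_
  · have h1 : (A.card : ℝ) ^ 4 ≤ N ^ 4 := by gcongr
    have h2 : ((A' - A').card : ℝ) * (κ * N / 2 / 2 * (κ * N / 33) ^ 2) ≤ N ^ 4 := by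
      refine le_trans ?_ (hmain.trans h1)
      gcongr
    have h3 : ((A' - A').card : ℝ) * (κ ^ 3 / 4356) * N ^ 3 ≤ N * N ^ 3 := by
      calc _ = _ := by ring
        _ ≤ _ := h2
        _ = _ := by ring
    have h4 := le_of_mul_le_mul_right h3 (by positivity)
    have h5 : (0 : ℝ) < κ ^ 3 := by positivity
    rw [div_mul_eq_mul_div, le_div_iff₀ h5]
    linarith
  · intro d hd
    obtain ⟨a, ha, b, hb, rfl⟩ := Finset.mem_sub.1 hd
    refine ⟨a, b, rfl, S \ (bad a ∪ bad b), ?_, ?_⟩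
    · have h1 := (Finset.mem_filter.1 ha).2
      have h2 := (Finset.mem_filter.1 hb).2
      have h3 := Finset.le_card_sdiff (bad a ∪ bad b) S
      have h4 := Finset.card_union_le (bad a) (bad b)
      omega
    · intro c hc
      simp only [Finset.mem_sdiff, Finset.mem_union, not_or, bad, Finset.mem_filter, not_and,
        not_lt] at hc
      exact ⟨hc.2.1 hc.1, hc.2.2 hc.1⟩

end BSG

/-! ### From a large `U³` norm to additive energy of the graph of large Fourier coefficients. -/

/-- The multiplicative derivative `x ↦ f(x) conj(f(x + h))`. -/
noncomputable def mderiv {n : ℕ} (f : F2 n → ℂ) (h x : F2 n) : ℂ := f x * conj (f (x + h))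

lemma norm_mderiv_le {n : ℕ} {f : F2 n → ℂ} (hf : ∀ x, ‖f x‖ ≤ 1) (h x : F2 n) :
    ‖mderiv f h x‖ ≤ 1 := by
  rw [mderiv, norm_mul]
  exact mul_le_one₀ (hf _) (norm_nonneg _) (by simpa using hf _)

lemma card_pow_mul_gowersU3Average {n : ℕ} (f : F2 n → ℂ) :
    (Fintype.card (F2 n) : ℝ) ^ 4 * (gowersU3Average f).re = ∑ h, gowersU2Sum (mderiv f h) := by
  have hN := (card_F2_pos n).ne'
  rw [gowersU3Average_eq, Complex.ofReal_re]
  simp only [Fintype.expect_eq_sum_div_card, norm_div, div_pow, ← Finset.sum_div, gowersU2Sum,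
    corr, mderiv]
  have : ∀ h k x : F2 n, f x * conj (f (x + h)) * conj (f (x + k)) * f (x + h + k) =
      f x * conj (f (x + h)) * conj (f (x + k) * conj (f (x + k + h))) := fun h k x => by
    rw [map_mul, Complex.conj_conj, add_right_comm]
    ring
  simp only [this, Complex.norm_natCast]
  field_simp

lemma sum_gowersU2Sum_mderiv_ge {n : ℕ} {f : F2 n → ℂ} {K : ℝ} (hK : 0 < K)
    (hf : IsApproxQuadratic K f) :
    (1 / K) ^ 8 * (Fintype.card (F2 n) : ℝ) ^ 4 ≤ ∑ h, gowersU2Sum (mderiv f h) := by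
  rw [← card_pow_mul_gowersU3Average, mul_comm]
  gcongr
  have h0 : 0 ≤ (gowersU3Average f).re := by
    have h1 := card_pow_mul_gowersU3Average f
    have h2 : 0 ≤ ∑ h, gowersU2Sum (mderiv f h) :=
      Finset.sum_nonneg fun h _ => Finset.sum_nonneg fun k _ => by positivity
    rw [← h1] at h2
    exact nonneg_of_mul_nonneg_right h2 (pow_pos (card_F2_pos n) 4)
  calc (1 / K) ^ 8 ≤ (gowersU3Norm f) ^ 8 := by gcongr; exact hf.2
    _ = (gowersU3Average f).re := by
        rw [gowersU3Norm, ← Real.rpow_natCast, ← Real.rpow_mul h0]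
        norm_num

lemma hat_conj {n : ℕ} (g : F2 n → ℂ) (ξ : F2 n) :
    hat (fun x => conj (g x)) ξ = conj (hat g ξ) := by
  simp [hat]

lemma norm_sq_hat_eq {n : ℕ} (g : F2 n → ℂ) (ξ : F2 n) :
    ((‖hat g ξ‖ ^ 2 : ℝ) : ℂ) =
      ∑ k, ∑ x, g x * conj (g (x + k)) * sgn (ξ ⬝ᵥ k) := by
  rw [norm_sq_eq_mul_conj, ← hat_conj, ← hat_corr]
  simp only [hat, corr, Finset.sum_mul]

lemma sum_pow_four_le {ι : Type*} [Fintype ι] (a : ι → ℝ) :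
    (∑ i, a i) ^ 4 ≤ (Fintype.card ι : ℝ) ^ 3 * ∑ i, a i ^ 4 := by
  have h1 := sq_sum_le_card_mul_sum_sq (s := Finset.univ) (f := a)
  have h2 := sq_sum_le_card_mul_sum_sq (s := Finset.univ) (f := fun i => a i ^ 2)
  simp only [Finset.card_univ, ← pow_mul] at h1 h2
  calc (∑ i, a i) ^ 4 = ((∑ i, a i) ^ 2) ^ 2 := by ring
    _ ≤ (Fintype.card ι * ∑ i, a i ^ 2) ^ 2 := by gcongr
    _ = (Fintype.card ι : ℝ) ^ 2 * (∑ i, a i ^ 2) ^ 2 := by ring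
    _ ≤ (Fintype.card ι : ℝ) ^ 2 * (Fintype.card ι * ∑ i, a i ^ (2 * 2)) := by gcongr
    _ = _ := by ring

section Quadruples

variable {n : ℕ} (S : Finset (F2 n)) (ξ : F2 n → F2 n)

/-- The graph of `ξ` over `S`. -/
def graphOver : Finset (F2 n × F2 n) := S.image fun h => (h, ξ h)

lemma card_graphOver : (graphOver S ξ).card = S.card :=
  Finset.card_image_of_injective _ fun _ _ h => (Prod.mk.inj h).1

variable {S ξ} in
lemma mem_graphOver {p : F2 n × F2 n} : p ∈ graphOver S ξ ↔ p.1 ∈ S ∧ ξ p.1 = p.2 := by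
  rw [graphOver, Finset.mem_image]
  constructor
  · rintro ⟨h, hh, rfl⟩; exact ⟨hh, rfl⟩
  · rintro ⟨h1, h2⟩; exact ⟨p.1, h1, Prod.ext rfl h2⟩

lemma card_popularFiber_graphOver (t τ : F2 n) :
    ((popularFiber (graphOver S ξ) (t, τ)).card : ℂ) =
      ∑ h, if h ∈ S ∧ h + t ∈ S ∧ ξ h + ξ (h + t) = τ then 1 else 0 := by
  have h1 : popularFiber (graphOver S ξ) (t, τ) =
      (Finset.univ.filter fun h => h ∈ S ∧ h + t ∈ S ∧ ξ h + ξ (h + t) = τ).image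
        fun h => (h, ξ h) := by
    ext ⟨h, η⟩
    simp only [popularFiber, Finset.mem_filter, mem_graphOver, Finset.mem_image, Finset.mem_univ,
      true_and, Prod.mk_add_mk, Prod.mk.injEq]
    constructor
    · rintro ⟨⟨h1, rfl⟩, h2, h3⟩
      refine ⟨h, ⟨h1, h2, ?_⟩, rfl, rfl⟩
      rw [h3, ← add_assoc, ZModModule.add_self, zero_add]
    · rintro ⟨h', ⟨h1, h2, rfl⟩, rfl, rfl⟩
      refine ⟨⟨h1, rfl⟩, h2, ?_⟩
      rw [← add_assoc, ZModModule.add_self, zero_add]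
  rw [h1, Finset.card_image_of_injective _ fun _ _ h => (Prod.mk.inj h).1]
  simp

/-- The indicator function of `S` twisted by the phases `ξ`. -/
noncomputable def twist (k h : F2 n) : ℂ := if h ∈ S then sgn (k ⬝ᵥ ξ h) else 0

/-- For fixed `t`, the autocorrelation at `t` of the twisted indicator, as a function of `k`, is the
Fourier transform in `τ` of the number of ways to write `(t, τ)` as a difference of graph points.
Parseval in `k` then produces the additive energy. -/
lemma sum_gowersU2Sum_twist :
    ∑ k, gowersU2Sum (twist S ξ k) =
      Fintype.card (F2 n) * ∑ z, ((popularFiber (graphOver S ξ) z).card : ℝ) ^ 2 := by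
  have h1 : ∀ k t, corr (twist S ξ k) (fun x => conj (twist S ξ k x)) t =
      hat (fun τ => ((popularFiber (graphOver S ξ) (t, τ)).card : ℂ)) k := fun k t => by
    simp only [hat, card_popularFiber_graphOver, Finset.sum_mul, corr]
    rw [Finset.sum_comm]
    refine Finset.sum_congr rfl fun h _ => ?_
    simp only [ite_and, ite_mul, one_mul, zero_mul, twist]
    split_ifs <;> simp [dotProduct_add, sgn_add]
  simp only [gowersU2Sum, h1]
  rw [Finset.sum_comm]
  simp only [sum_norm_sq_hat, Complex.norm_natCast]
  rw [← Finset.mul_sum, Fintype.sum_prod_type]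

/-- The crux is the symmetry of second derivatives: differentiating in `h` and then `k` equals
differentiating in `k` and then `h`. After the squares are expanded the sum is, for each `k`, a
bilinear expression in the bounded function `mderiv f k` with kernel `twist S ξ k`, so it is
controlled by the `U²` norm of the twist. -/
lemma sum_norm_sq_hat_pow_four_le {f : F2 n → ℂ} (hf : ∀ x, ‖f x‖ ≤ 1) :
    (∑ h ∈ S, ‖hat (mderiv f h) (ξ h)‖ ^ 2) ^ 4 ≤
      (Fintype.card (F2 n) : ℝ) ^ 9 *
        ∑ z, ((popularFiber (graphOver S ξ) z).card : ℝ) ^ 2 := by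
  set N : ℝ := (Fintype.card (F2 n) : ℝ)
  have h1 : ((∑ h ∈ S, ‖hat (mderiv f h) (ξ h)‖ ^ 2 : ℝ) : ℂ) =
      ∑ k, ∑ x, ∑ h, mderiv f k x * (twist S ξ k h * conj (mderiv f k (x + h))) := by
    push_cast only [Complex.ofReal_sum]
    simp only [norm_sq_hat_eq]
    rw [Finset.sum_comm]
    refine Finset.sum_congr rfl fun k _ => ?_
    rw [Finset.sum_comm]
    refine Finset.sum_congr rfl fun x _ => ?_
    rw [← Finset.sum_subset (Finset.subset_univ S)]
    · refine Finset.sum_congr rfl fun h hh => ?_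
      simp only [mderiv, twist, if_pos hh, map_mul, Complex.conj_conj, dotProduct_comm k,
        add_right_comm x k h]
      ring
    · intro h _ hh
      simp [twist, hh]
  have h2 : ∑ h ∈ S, ‖hat (mderiv f h) (ξ h)‖ ^ 2 ≤
      ∑ k, ‖∑ x, ∑ h, mderiv f k x * (twist S ξ k h * conj (mderiv f k (x + h)))‖ := by
    refine le_trans ?_ (norm_sum_le _ _)
    rw [← h1, Complex.norm_real]
    exact le_abs_self _
  calc _ ≤ _ := by gcongr
    _ ≤ _ := sum_pow_four_le _
    _ ≤ N ^ 3 * ∑ k, N ^ 5 * gowersU2Sum (twist S ξ k) := by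
        gcongr with k
        exact norm_sum_pow_four_le_gowersU2Sum (b := fun x => conj (mderiv f k x))
          (norm_mderiv_le hf k) (by simpa using norm_mderiv_le hf k) _
    _ = _ := by rw [← Finset.mul_sum, sum_gowersU2Sum_twist]; ring

end Quadruples

/-- Take `ξ h` to be the frequency supplied by the `U²` inverse theorem and `S` the set of `h` where
its coefficient passes the threshold. The discarded `h` account for at most half of the mass. -/
lemma exists_energy_ge {n : ℕ} {f : F2 n → ℂ} {δ : ℝ} (hf : ∀ x, ‖f x‖ ≤ 1) (hδ : 0 < δ)
    (h : δ * (Fintype.card (F2 n) : ℝ) ^ 4 ≤ ∑ h, gowersU2Sum (mderiv f h)) :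
    ∃ (S : Finset (F2 n)) (ξ : F2 n → F2 n),
      (∀ h ∈ S, δ / 2 * (Fintype.card (F2 n) : ℝ) ^ 2 ≤ ‖hat (mderiv f h) (ξ h)‖ ^ 2) ∧
      (δ / 2) ^ 4 * (Fintype.card (F2 n) : ℝ) ^ 3 ≤
        ∑ z, ((popularFiber (graphOver S ξ) z).card : ℝ) ^ 2 := by
  classical
  have hN := card_F2_pos n
  set N : ℝ := (Fintype.card (F2 n) : ℝ) with hNdef
  choose ξ hξ using fun h => exists_gowersU2Sum_le (norm_mderiv_le hf h)
  set S := Finset.univ.filter fun h => δ / 2 * N ^ 2 ≤ ‖hat (mderiv f h) (ξ h)‖ ^ 2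
  refine ⟨S, ξ, fun h hh => (Finset.mem_filter.1 hh).2, ?_⟩
  have h1 : δ * N ^ 3 ≤ ∑ h, ‖hat (mderiv f h) (ξ h)‖ ^ 2 := by
    have h2 := h.trans (Finset.sum_le_sum fun h _ => hξ h)
    rw [← Finset.mul_sum] at h2
    refine le_of_mul_le_mul_left ?_ hN
    linarith
  have h2 : δ / 2 * N ^ 3 ≤ ∑ h ∈ S, ‖hat (mderiv f h) (ξ h)‖ ^ 2 := by
    rw [← Finset.sum_filter_add_sum_filter_not _
      (fun h => δ / 2 * N ^ 2 ≤ ‖hat (mderiv f h) (ξ h)‖ ^ 2)] at h1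
    have h3 : ∑ h with ¬ δ / 2 * N ^ 2 ≤ ‖hat (mderiv f h) (ξ h)‖ ^ 2,
        ‖hat (mderiv f h) (ξ h)‖ ^ 2 ≤ N * (δ / 2 * N ^ 2) := by
      refine (Finset.sum_le_card_nsmul _ _ (δ / 2 * N ^ 2) fun h hh =>
        (not_le.1 (Finset.mem_filter.1 hh).2).le).trans ?_
      rw [nsmul_eq_mul]
      gcongr
      rw [hNdef]
      exact_mod_cast Finset.card_le_univ _
    linarith
  refine le_of_mul_le_mul_left ?_ (pow_pos hN 9)
  refine le_trans ?_ (sum_norm_sq_hat_pow_four_le S ξ hf)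
  calc _ = (δ / 2 * N ^ 3) ^ 4 := by ring
    _ ≤ _ := by gcongr

/-! ### Freiman–Ruzsa applied to a graph: an affine map agreeing with `ξ` on many points. -/

/-- The polynomial Freiman–Ruzsa statement over `𝔽₂^∞` with exponent `C`. -/
def PolynomialFreimanRuzsa (C : ℝ) : Prop :=
  ∀ K : ℝ, 2 ≤ K → ∀ A : Set (ℕ →₀ ZMod 2), IsApproxGroup K A →
    ∃ H : AddSubgroup (ℕ →₀ ZMod 2), (H : Set (ℕ →₀ ZMod 2)).Finite ∧
      Controls (K ^ C) (H : Set (ℕ →₀ ZMod 2)) A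

lemma exists_injective_linearMap_finsupp (V : Type*) [AddCommGroup V] [Module (ZMod 2) V]
    [Finite V] : ∃ ι : V →ₗ[ZMod 2] (ℕ →₀ ZMod 2), Function.Injective ι := by
  have : Module.Finite (ZMod 2) V := Module.Finite.of_finite
  let b := Module.finBasis (ZMod 2) V
  refine ⟨(Finsupp.lmapDomain (ZMod 2) (ZMod 2) Fin.val) ∘ₗ b.repr.toLinearMap, ?_⟩
  exact (Finsupp.mapDomain_injective Fin.val_injective).comp b.repr.injective

lemma exists_card_le_mul_card_fiber {α β : Type*} [DecidableEq β] {s : Finset α} {t : Finset β}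
    {f : α → β} (hf : ∀ a ∈ s, f a ∈ t) (ht : t.Nonempty) :
    ∃ y ∈ t, (s.card : ℝ) ≤ t.card * (s.filter fun x => f x = y).card := by
  have h0 : (0 : ℝ) < t.card := by exact_mod_cast ht.card_pos
  obtain ⟨y, hy, h⟩ := Finset.exists_le_card_fiber_of_nsmul_le_card_of_maps_to
    (b := (s.card : ℝ) / t.card) hf ht (by rw [nsmul_eq_mul, mul_div_cancel₀ _ h0.ne'])
  exact ⟨y, hy, by rwa [div_le_iff₀ h0, mul_comm] at h⟩

/-- Plünnecke–Ruzsa bounds `|5A|`, and Ruzsa covering of `4A` by translates of `A - A = A + A`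
follows. Hence `A + A`, rather than `A`, is the approximate group to be used. -/
lemma covered_add_add_of_small_doubling {V : Type*} [AddCommGroup V] [Module (ZMod 2) V]
    [DecidableEq V] {A : Finset V} (hA : A.Nonempty) {L : ℝ}
    (hL : ((A + A).card : ℝ) ≤ L * A.card) :
    ∃ X : Finset V, (X.card : ℝ) ≤ L ^ 5 ∧ (A + A) + (A + A) ⊆ X + (A + A) := by
  have hA0 : (0 : ℝ) < A.card := by exact_mod_cast hA.card_pos
  have hneg : -A = A := by
    ext x
    rw [Finset.mem_neg', ZModModule.neg_eq_self]
  have h5 := Finset.pluennecke_ruzsa_inequality_nsmul_add hA A 5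
  have h5' : (((A + A) + (A + A) + A).card : ℝ) ≤ L ^ 5 * A.card := by
    have : (A + A) + (A + A) + A = 5 • A := by abel
    rw [this]
    have h6 : (((A + A).card / A.card : NNRat) : ℝ) ≤ L := by
      push_cast
      rwa [div_le_iff₀ hA0]
    have h7 : ((5 • A).card : ℝ) ≤ ((((A + A).card / A.card : NNRat) : ℝ)) ^ 5 * A.card := by
      exact_mod_cast h5
    exact h7.trans (by gcongr)
  obtain ⟨X, -, hX, hcov⟩ := Finset.ruzsa_covering_add hA h5'
  refine ⟨X, hX, ?_⟩
  rwa [sub_eq_add_neg, hneg] at hcov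

lemma exists_subgroup_of_small_doubling {C : ℝ} (hC : PolynomialFreimanRuzsa C)
    {V : Type*} [AddCommGroup V] [Module (ZMod 2) V] [Finite V] [DecidableEq V]
    {A : Finset V} (hA : A.Nonempty) {L : ℝ} (hL2 : 2 ≤ L)
    (hL : ((A + A).card : ℝ) ≤ L * A.card) :
    ∃ (H : AddSubgroup V) (A' : Finset V) (a₀ : V), A' ⊆ A ∧ (∀ a ∈ A', a - a₀ ∈ H) ∧
      (Nat.card H : ℝ) ≤ (L ^ 5) ^ C * (L * A.card) ∧
      (A.card : ℝ) ≤ (L ^ 5) ^ C * A'.card := by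
  classical
  have hA0 : (0 : ℝ) < A.card := by exact_mod_cast hA.card_pos
  obtain ⟨ι, hι⟩ := exists_injective_linearMap_finsupp V
  obtain ⟨X, hX, hcov⟩ := covered_add_add_of_small_doubling hA hL
  have happ : IsApproxGroup (L ^ 5) (ι '' (↑(A + A) : Set V)) := by
    refine ⟨(Finset.finite_toSet _).image _, ?_, ?_, X.image ι, ?_, ?_⟩
    · exact (Finset.coe_nonempty.2 (hA.add hA)).image _
    · intro x hx
      rwa [ZModModule.neg_eq_self]
    · exact le_trans (by exact_mod_cast Finset.card_image_le) hX
    · rw [Finset.coe_image, ← Set.image_add, ← Set.image_add]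
      exact Set.image_mono (by exact_mod_cast hcov)
  have hL5 : 2 ≤ L ^ 5 := hL2.trans (le_self_pow₀ (by linarith) (by norm_num))
  obtain ⟨H, hHfin, -, -, hHcard, Y, hY, hAY⟩ := hC _ hL5 _ happ
  set M : ℝ := (L ^ 5) ^ C
  have hM : 0 < M := Real.rpow_pos_of_pos (by positivity) _
  obtain ⟨b, hb⟩ := hA
  -- The translate `A + b` lies inside the controlled set `A + A`, so cosets covering `A + A` also
  -- serve for `A`.
  have hmem : ∀ a ∈ A, ∃ y ∈ Y, ι (a + b) - y ∈ H := by
    intro a ha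
    obtain ⟨h, hh, y, hy, e⟩ := Set.mem_add.1
      (hAY (Set.mem_image_of_mem ι (Finset.mem_coe.2 (Finset.add_mem_add ha hb))))
    exact ⟨y, hy, by rw [← e]; simpa using hh⟩
  choose! y hyY hyH using hmem
  obtain ⟨y₀, hy₀, hcard⟩ := exists_card_le_mul_card_fiber hyY ⟨_, hyY b hb⟩
  have hcard' : (A.card : ℝ) ≤ M * (A.filter fun a => y a = y₀).card := hcard.trans (by gcongr)
  have hne : (A.filter fun a => y a = y₀).Nonempty := by
    rw [← Finset.card_pos]
    by_contra! h0
    rw [Nat.le_zero.1 h0] at hcard'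
    simp at hcard'
    exact absurd hA0 (by simp [hcard'])
  obtain ⟨a₀, ha₀⟩ := hne
  refine ⟨H.comap ι.toAddMonoidHom, A.filter fun a => y a = y₀, a₀, Finset.filter_subset _ _,
    ?_, ?_, hcard'⟩
  · intro a ha
    rw [Finset.mem_filter] at ha ha₀
    have h1 := hyH a ha.1
    have h2 := hyH a₀ ha₀.1
    rw [ha.2] at h1
    rw [ha₀.2] at h2
    have h3 := H.sub_mem h1 h2
    simp only [AddSubgroup.mem_comap, LinearMap.toAddMonoidHom_coe]
    convert h3 using 1
    simp only [map_add, map_sub]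
    abel
  · have h1 : Nat.card (H.comap ι.toAddMonoidHom) ≤ (H : Set (ℕ →₀ ZMod 2)).ncard := by
      have : Finite H := hHfin
      refine Nat.card_le_card_of_injective
        (fun x : H.comap ι.toAddMonoidHom => (⟨ι x, x.2⟩ : H)) fun x x' h => ?_
      exact Subtype.ext (hι (congrArg Subtype.val h))
    rw [Set.ncard_image_of_injective _ hι, Set.ncard_coe_finset] at hHcard
    calc (Nat.card (H.comap ι.toAddMonoidHom) : ℝ) ≤ _ := Nat.cast_le.2 h1
      _ ≤ _ := hHcard
      _ ≤ _ := by gcongr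

/-- The subgroup `H` is fibred over its first projection, and a linear section of that projection
gives `M`. Points of `A - a₀` deviate from the graph of `M` by a vertical vector of `H`. As `A` is a
graph, its translates by the vertical vectors are disjoint, so there are at most `|H| / |A|` of
them, and one deviation is popular. -/
lemma exists_linearMap_of_graphOver {n : ℕ} {S : Finset (F2 n)} {ξ : F2 n → F2 n}
    (H : AddSubgroup (F2 n × F2 n)) {A : Finset (F2 n × F2 n)} (hA : A ⊆ graphOver S ξ)
    {a₀ : F2 n × F2 n} (hH : ∀ a ∈ A, a - a₀ ∈ H) :
    ∃ (M : F2 n →ₗ[ZMod 2] F2 n) (η : F2 n),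
      (A.card : ℝ) ^ 2 ≤ Nat.card H * (S.filter fun h => ξ h = M h + η).card := by
  classical
  let H' : Submodule (ZMod 2) (F2 n × F2 n) := AddSubgroup.toZModSubmodule 2 H
  have hH' : ∀ q, q ∈ H' ↔ q ∈ H := fun q => AddSubgroup.mem_toZModSubmodule 2
  obtain ⟨M, hM⟩ : ∃ M : F2 n →ₗ[ZMod 2] F2 n, ∀ q ∈ H, (q.1, M q.1) ∈ H := by
    let F : H' →ₗ[ZMod 2] F2 n := LinearMap.fst _ _ _ ∘ₗ H'.subtype
    obtain ⟨s, hs⟩ := F.rangeRestrict.exists_rightInverse_of_surjective F.range_rangeRestrict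
    -- The section is defined only on the projection of `H`; its second coordinate is extended to
    -- the whole space.
    obtain ⟨M, hM⟩ := LinearMap.exists_extend (LinearMap.snd _ _ _ ∘ₗ H'.subtype ∘ₗ s)
    refine ⟨M, fun q hq => ?_⟩
    have h1 : F ⟨q, (hH' q).2 hq⟩ = q.1 := rfl
    set p : F.range := F.rangeRestrict ⟨q, (hH' q).2 hq⟩
    have h2 : (s p : F2 n × F2 n).1 = q.1 := by
      have := congrArg Subtype.val (LinearMap.congr_fun hs p)
      exact this
    have h3 : M q.1 = (s p : F2 n × F2 n).2 := LinearMap.congr_fun hM p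
    rw [← h2] at h3 ⊢
    rw [h3]
    exact (hH' _).1 (s p).2
  let Z : Finset (F2 n) := Finset.univ.filter fun ζ => ((0, ζ) : F2 n × F2 n) ∈ H
  have hZ0 : Z.Nonempty := ⟨0, Finset.mem_filter.2 ⟨Finset.mem_univ _, H.zero_mem⟩⟩
  have hZA : Z.card * A.card ≤ Nat.card H := by
    rw [← Finset.card_product, show Nat.card H = (H : Set (F2 n × F2 n)).toFinset.card from
      Nat.card_eq_card_toFinset (H : Set (F2 n × F2 n))]
    refine Finset.card_le_card_of_injOn (fun p => (p.2 - a₀) + (0, p.1)) ?_ ?_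
    · rintro ⟨ζ, a⟩ h
      rw [Finset.mem_coe, Finset.mem_product] at h
      simp only [Set.coe_toFinset, SetLike.mem_coe]
      exact H.add_mem (hH a h.2) (Finset.mem_filter.1 h.1).2
    · rintro ⟨ζ, a⟩ h ⟨ζ', a'⟩ h' e
      rw [Finset.mem_coe, Finset.mem_product] at h h'
      obtain ⟨e1, e2⟩ := Prod.ext_iff.1 e
      simp only [Prod.fst_add, Prod.fst_sub, add_zero, sub_left_inj, Prod.snd_add,
        Prod.snd_sub] at e1 e2
      have h1 := (mem_graphOver.1 (hA h.2)).2
      have h2 := (mem_graphOver.1 (hA h'.2)).2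
      have e3 : a = a' := Prod.ext e1 (by rw [← h1, ← h2, e1])
      subst e3
      simpa using e2
  obtain ⟨ζ, hζ, hcard⟩ := exists_card_le_mul_card_fiber (s := A) (t := Z)
    (f := fun a => (a - a₀).2 - M (a - a₀).1) (fun a ha => by
      simp only [Z, Finset.mem_filter, Finset.mem_univ, true_and]
      have := H.sub_mem (hH a ha) (hM _ (hH a ha))
      simpa [Prod.sub_def] using this) hZ0
  refine ⟨M, ζ + a₀.2 - M a₀.1, ?_⟩
  have hle : (A.filter fun a => (a - a₀).2 - M (a - a₀).1 = ζ).card ≤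
      (S.filter fun h => ξ h = M h + (ζ + a₀.2 - M a₀.1)).card := by
    refine Finset.card_le_card_of_injOn Prod.fst ?_ ?_
    · intro a ha
      simp only [Finset.coe_filter, Set.mem_ofPred_eq] at ha ⊢
      obtain ⟨h1, h2⟩ := mem_graphOver.1 (hA ha.1)
      refine ⟨h1, ?_⟩
      rw [h2, ← ha.2]
      simp only [Prod.snd_sub, Prod.fst_sub, map_sub]
      abel
    · intro a ha a' ha' e
      simp only [Finset.coe_filter, Set.mem_ofPred_eq] at ha ha'
      have h1 := (mem_graphOver.1 (hA ha.1)).2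
      have h2 := (mem_graphOver.1 (hA ha'.1)).2
      exact Prod.ext e (by rw [← h1, ← h2, e])
  calc (A.card : ℝ) ^ 2 = A.card * A.card := sq _
    _ ≤ A.card * (Z.card * (S.filter fun h => ξ h = M h + (ζ + a₀.2 - M a₀.1)).card) := by
        gcongr
        exact hcard.trans (by gcongr)
    _ = (Z.card * A.card : ℕ) * (S.filter fun h => ξ h = M h + (ζ + a₀.2 - M a₀.1)).card := by
        push_cast; ring
    _ ≤ _ := by gcongr

/-! ### The symmetry argument and polarisation of alternating forms. -/

section Box

variable {n : ℕ}

/-- The sum of `f₁(x) f₂(x + h) f₃(x + k) f₄(x + h + k) (-1)^{B(h, k)}` over `x`, `h`, `k`. -/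
noncomputable def boxSum (B : F2 n → F2 n → ZMod 2) (f₁ f₂ f₃ f₄ : F2 n → ℂ) : ℂ :=
  ∑ h, ∑ k, ∑ x, f₁ x * f₂ (x + h) * f₃ (x + k) * f₄ (x + h + k) * sgn (B h k)

lemma norm_mul_sgn_le {f : F2 n → ℂ} (hf : ∀ x, ‖f x‖ ≤ 1) (q : F2 n → ZMod 2) (x : F2 n) :
    ‖f x * sgn (q x)‖ ≤ 1 := by
  rw [norm_mul, norm_sgn, mul_one]
  exact hf x

lemma sum_norm_sq_hat_mderiv_eq_boxSum (f : F2 n → ℂ) (M : F2 n →ₗ[ZMod 2] F2 n) (η : F2 n) :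
    ((∑ h, ‖hat (mderiv f h) (M h + η)‖ ^ 2 : ℝ) : ℂ) =
      boxSum (fun h k => M h ⬝ᵥ k) (fun x => f x * sgn (η ⬝ᵥ x)) (fun x => conj (f x))
        (fun x => conj (f x) * sgn (η ⬝ᵥ x)) f := by
  push_cast only [Complex.ofReal_sum]
  simp only [norm_sq_hat_eq, boxSum, mderiv]
  refine Finset.sum_congr rfl fun h _ => Finset.sum_congr rfl fun k _ =>
    Finset.sum_congr rfl fun x _ => ?_
  rw [map_mul, Complex.conj_conj, add_right_comm x k h, add_dotProduct, dotProduct_add, sgn_add,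
    sgn_add]
  linear_combination (-f x * conj (f (x + h)) * (conj (f (x + k)) * f (x + h + k)) *
    (sgn (M h ⬝ᵥ k) * sgn (η ⬝ᵥ k))) * sgn_mul_self (η ⬝ᵥ x)

lemma exists_dotProduct (l : F2 n →ₗ[ZMod 2] ZMod 2) : ∃ v : F2 n, ∀ x, l x = v ⬝ᵥ x := by
  refine ⟨fun i => l (Pi.single i 1), fun x => ?_⟩
  rw [LinearMap.pi_apply_eq_sum_univ l x, dotProduct]
  refine Finset.sum_congr rfl fun i _ => ?_
  rw [smul_eq_mul, mul_comm]
  congr 2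
  ext j
  simp [Pi.single_apply, eq_comm]

lemma exists_linearMap_dotProduct (D : F2 n →ₗ[ZMod 2] F2 n →ₗ[ZMod 2] ZMod 2) :
    ∃ E : F2 n → F2 n, (∀ x y, D x y = E x ⬝ᵥ y) := by
  choose E hE using fun x => exists_dotProduct (D x)
  exact ⟨E, hE⟩

/-- The inner sum is a Fourier coefficient of `b` at the frequency representing `D x`. Each
frequency occurs at most `|ker D|` times, so Cauchy–Schwarz and Parseval suffice. -/
lemma norm_sq_sum_bilinear_le {a b : F2 n → ℂ} (ha : ∀ x, ‖a x‖ ≤ 1) (hb : ∀ x, ‖b x‖ ≤ 1)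
    (D : F2 n →ₗ[ZMod 2] F2 n →ₗ[ZMod 2] ZMod 2) :
    ‖∑ x, ∑ y, a x * (b y * sgn (D x y))‖ ^ 2 ≤
      (Fintype.card (F2 n) : ℝ) ^ 3 * (Finset.univ.filter fun x => D x = 0).card := by
  classical
  obtain ⟨E, hE⟩ := exists_linearMap_dotProduct D
  set N : ℝ := (Fintype.card (F2 n) : ℝ)
  have h1 : ∀ x, ∑ y, a x * (b y * sgn (D x y)) = a x * hat b (E x) := fun x => by
    simp only [hat, Finset.mul_sum, hE]
  have h2 : ∀ ξ, ((Finset.univ.filter fun x => E x = ξ).card : ℝ) ≤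
      (Finset.univ.filter fun x => D x = 0).card := by
    intro ξ
    rcases (Finset.univ.filter fun x => E x = ξ).eq_empty_or_nonempty with h | ⟨x₀, hx₀⟩
    · rw [h]; simp
    · refine Nat.cast_le.2 (Finset.card_le_card_of_injOn (fun x => x - x₀) ?_ ?_)
      · intro x hx
        simp only [Finset.coe_filter, Finset.mem_univ, true_and, Set.mem_ofPred_eq,
          Finset.mem_filter] at hx hx₀ ⊢
        refine LinearMap.ext fun y => ?_
        rw [map_sub, LinearMap.sub_apply, hE, hE, hx, hx₀, sub_self, LinearMap.zero_apply]
      · intro x _ y _ h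
        simpa using h
  have h3 : ∑ x, ‖hat b (E x)‖ ^ 2 ≤
      (Finset.univ.filter fun x => D x = 0).card * (N * N) := by
    rw [← Finset.sum_fiberwise_of_maps_to (g := E) (t := Finset.univ)
      (fun _ _ => Finset.mem_univ _)]
    calc _ ≤ ∑ ξ, (Finset.univ.filter fun x => D x = 0).card * ‖hat b ξ‖ ^ 2 := by
          refine Finset.sum_le_sum fun ξ _ => ?_
          rw [Finset.sum_congr rfl (g := fun _ => ‖hat b ξ‖ ^ 2)
            (fun x hx => by rw [(Finset.mem_filter.1 hx).2]), Finset.sum_const, nsmul_eq_mul]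
          exact mul_le_mul_of_nonneg_right (h2 ξ) (by positivity)
      _ ≤ _ := by
          rw [← Finset.mul_sum, sum_norm_sq_hat]
          gcongr
          exact sum_norm_sq_le_card hb
  simp only [h1]
  refine (norm_sq_sum_mul_le ha _).trans ?_
  calc N * ∑ x, ‖hat b (E x)‖ ^ 2
      ≤ N * ((Finset.univ.filter fun x => D x = 0).card * (N * N)) := by gcongr
    _ = _ := by ring

/-- Substitute `z = h + k` and `y = x + k`. For fixed `z`, the arguments of `f₁, f₄` depend only on
`x` and those of `f₂, f₃` only on `y`, so the only interaction left is the cross term `B(x, y) +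
B(y, x)` of the phase. -/
lemma boxSum_eq_sum_bilinear (B : F2 n →ₗ[ZMod 2] F2 n →ₗ[ZMod 2] ZMod 2)
    (f₁ f₂ f₃ f₄ : F2 n → ℂ) :
    boxSum (fun h k => B h k) f₁ f₂ f₃ f₄ = ∑ z, ∑ x, ∑ y,
      (f₁ x * f₄ (x + z) * sgn (B x x + B z x)) *
        ((f₂ (y + z) * f₃ y * sgn (B y y + B z y)) * sgn ((B + B.flip) x y)) := by
  let e : F2 n × F2 n × F2 n ≃ F2 n × F2 n × F2 n :=
    { toFun := fun p => (p.1 + p.2.1, p.2.2, p.2.2 + p.2.1)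
      invFun := fun p => (p.1 + p.2.1 + p.2.2, p.2.1 + p.2.2, p.2.1)
      left_inv := fun ⟨h, k, x⟩ => by
        ext i <;> simp only [Pi.add_apply] <;> grind
      right_inv := fun ⟨z, x, y⟩ => by
        ext i <;> simp only [Pi.add_apply] <;> grind }
  simp only [boxSum, ← Fintype.sum_prod_type']
  refine (Fintype.sum_equiv e.symm _ _ fun p => ?_).symm
  obtain ⟨z, x, y⟩ := p
  simp only [e, Equiv.coe_fn_symm_mk]
  have h1 : x + (z + x + y) = y + z := by
    ext i; simp only [Pi.add_apply]; grind
  have h2 : x + (x + y) = y := by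
    ext i; simp only [Pi.add_apply]; grind
  have h3 : x + (z + x + y) + (x + y) = x + z := by
    ext i; simp only [Pi.add_apply]; grind
  have h4 : B (z + x + y) (x + y) =
      (B x x + B z x) + ((B y y + B z y) + (B + B.flip) x y) := by
    simp only [map_add, LinearMap.add_apply, LinearMap.flip_apply]
    ring
  rw [h3, h1, h2, h4]
  simp only [sgn_add]
  ring

/-- A large box sum forces `B` to be nearly symmetric: for some `z` the bilinear sum with form `B +
Bᵀ` is large, which is impossible unless that form has a large kernel. -/
lemma card_ker_ge_of_boxSum {B : F2 n →ₗ[ZMod 2] F2 n →ₗ[ZMod 2] ZMod 2}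
    {f₁ f₂ f₃ f₄ : F2 n → ℂ} (h₁ : ∀ x, ‖f₁ x‖ ≤ 1) (h₂ : ∀ x, ‖f₂ x‖ ≤ 1)
    (h₃ : ∀ x, ‖f₃ x‖ ≤ 1) (h₄ : ∀ x, ‖f₄ x‖ ≤ 1) {ρ : ℝ} (hρ : 0 ≤ ρ)
    (h : ρ * (Fintype.card (F2 n) : ℝ) ^ 3 ≤ ‖boxSum (fun h k => B h k) f₁ f₂ f₃ f₄‖) :
    ρ ^ 2 * Fintype.card (F2 n) ≤
      (Finset.univ.filter fun x => (B + B.flip) x = 0).card := by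
  have hN := card_F2_pos n
  rw [boxSum_eq_sum_bilinear] at h
  obtain ⟨z, -, hz⟩ := Finset.exists_le_of_sum_le (s := Finset.univ) (g := fun z =>
    ‖∑ x, ∑ y, (f₁ x * f₄ (x + z) * sgn (B x x + B z x)) *
        ((f₂ (y + z) * f₃ y * sgn (B y y + B z y)) * sgn ((B + B.flip) x y))‖)
    (f := fun _ => ρ * (Fintype.card (F2 n) : ℝ) ^ 2) ⟨0, Finset.mem_univ _⟩ (by
      refine le_trans (le_of_eq ?_) (h.trans (norm_sum_le _ _))
      rw [Finset.sum_const, nsmul_eq_mul, Finset.card_univ]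
      ring)
  have hb : ∀ (f g : F2 n → ℂ) (q : F2 n → ZMod 2), (∀ x, ‖f x‖ ≤ 1) → (∀ x, ‖g x‖ ≤ 1) →
      ∀ x y, ‖f x * g y * sgn (q x)‖ ≤ 1 := fun f g q hf hg x y => by
    rw [norm_mul, norm_sgn, mul_one, norm_mul]
    exact mul_le_one₀ (hf _) (norm_nonneg _) (hg _)
  have h5 := norm_sq_sum_bilinear_le
    (a := fun x => f₁ x * f₄ (x + z) * sgn (B x x + B z x))
    (b := fun y => f₂ (y + z) * f₃ y * sgn (B y y + B z y))
    (fun x => hb f₁ (fun x => f₄ (x + z)) (fun x => B x x + B z x) h₁ (fun x => h₄ _) x x)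
    (fun x => hb (fun x => f₂ (x + z)) f₃ (fun x => B x x + B z x) (fun x => h₂ _) h₃ x x)
    (B + B.flip)
  refine le_of_mul_le_mul_left ?_ (pow_pos hN 3)
  refine le_trans ?_ h5
  calc _ = (ρ * (Fintype.card (F2 n) : ℝ) ^ 2) ^ 2 := by ring
    _ ≤ _ := by gcongr

/-- An alternating form over `𝔽₂` is the polarisation of a quadratic form. -/
lemma exists_quadratic_of_alternating {B : F2 n →ₗ[ZMod 2] F2 n →ₗ[ZMod 2] ZMod 2}
    (hB : ∀ x, B x x = 0) : ∃ q : F2 n → ZMod 2, ∀ x y, q (x + y) = q x + q y + B x y := by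
  have hsymm : ∀ x y, B x y = B y x := fun x y => by
    have h := hB (x + y)
    simp only [map_add, LinearMap.add_apply, hB, zero_add, add_zero] at h
    grind
  let b : Fin n → Fin n → ZMod 2 := fun i j => B (Pi.single i 1) (Pi.single j 1)
  have hexp : ∀ x y, B x y = ∑ i, ∑ j, x i * y j * b i j := fun x y => by
    have h1 : ∀ x : F2 n, x = ∑ i, x i • (Pi.single i 1 : F2 n) := fun x => by
      ext j
      simp [Pi.single_apply]
    conv_lhs => rw [h1 x, h1 y]
    simp only [map_sum, map_smul, LinearMap.sum_apply, LinearMap.smul_apply, smul_eq_mul, b,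
      Finset.mul_sum]
    rw [Finset.sum_comm]
    refine Finset.sum_congr rfl fun i _ => Finset.sum_congr rfl fun j _ => ?_
    ring
  -- Only the entries above the diagonal are used: division by 2 is not available, and the diagonal
  -- of an alternating form vanishes.
  refine ⟨fun x => ∑ i, ∑ j, if i < j then x i * x j * b i j else 0, fun x y => ?_⟩
  have h2 : B x y = (∑ i, ∑ j, if i < j then x i * y j * b i j else 0) +
      ∑ i, ∑ j, if i < j then x j * y i * b i j else 0 := by
    rw [hexp, Finset.sum_comm (f := fun i j => if i < j then x j * y i * b i j else 0)]
    simp only [← Finset.sum_add_distrib]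
    refine Finset.sum_congr rfl fun i _ => Finset.sum_congr rfl fun j _ => ?_
    rcases lt_trichotomy i j with hij | rfl | hij
    · simp [hij, hij.not_gt]
    · simp [b, hB]
    · have : b j i = b i j := hsymm _ _
      simp [hij, hij.not_gt, this]
  rw [h2]
  simp only [← Finset.sum_add_distrib]
  refine Finset.sum_congr rfl fun i _ => Finset.sum_congr rfl fun j _ => ?_
  split_ifs
  · simp only [Pi.add_apply]; ring
  · simp

lemma isQuadraticPolynomial_of_polarization {q : F2 n → ZMod 2}
    {B : F2 n →ₗ[ZMod 2] F2 n →ₗ[ZMod 2] ZMod 2}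
    (h : ∀ x y, q (x + y) = q x + q y + B x y) : IsQuadraticPolynomial q := by
  intro a b c x
  simp only [fwdDiff, h, map_add, LinearMap.add_apply]
  ring

/-- Without a phase, the box sum is the inner product of the correlation of `F₂, F₄` with that of
`F₁, F₃`. The former is bounded trivially; Plancherel bounds the latter by the largest coefficient
of `F₁`. -/
lemma exists_hat_ge_of_boxSum {F₁ F₂ F₃ F₄ : F2 n → ℂ} (h₂ : ∀ x, ‖F₂ x‖ ≤ 1)
    (h₃ : ∀ x, ‖F₃ x‖ ≤ 1) (h₄ : ∀ x, ‖F₄ x‖ ≤ 1) {τ : ℝ} (hτ : 0 ≤ τ)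
    (h : τ * (Fintype.card (F2 n) : ℝ) ^ 3 ≤ ‖boxSum (fun _ _ => 0) F₁ F₂ F₃ F₄‖) :
    ∃ ξ, τ * Fintype.card (F2 n) ≤ ‖hat F₁ ξ‖ := by
  have hN := card_F2_pos n
  set N : ℝ := (Fintype.card (F2 n) : ℝ)
  have h1 : boxSum (fun _ _ => 0) F₁ F₂ F₃ F₄ =
      N * ∑ k, corr F₂ F₄ k / N * corr F₁ F₃ k := by
    have hN' : (N : ℂ) ≠ 0 := by exact_mod_cast hN.ne'
    simp only [div_mul_eq_mul_div, ← Finset.sum_div, mul_div_cancel₀ _ hN', boxSum]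
    rw [Finset.sum_comm]
    refine Finset.sum_congr rfl fun k _ => ?_
    rw [Finset.sum_comm, mul_comm]
    simp only [corr, Finset.sum_mul_sum]
    refine Finset.sum_congr rfl fun x _ => ?_
    refine Fintype.sum_equiv (Equiv.addLeft x) _ _ fun y => ?_
    simp only [Equiv.coe_addLeft, sgn_zero]
    ring
  obtain ⟨ξ, -, hξ⟩ := Finset.exists_max_image Finset.univ (fun ξ => ‖hat F₁ ξ‖ ^ 2) ⟨0, by simp⟩
  refine ⟨ξ, ?_⟩
  have h5 : ∀ t, ‖corr F₂ F₄ t / N‖ ≤ 1 := fun t => by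
    rw [norm_div, Complex.norm_real, Real.norm_of_nonneg hN.le, div_le_one hN]
    refine norm_sum_le_card fun x => ?_
    rw [norm_mul]
    exact mul_le_one₀ (h₂ _) (norm_nonneg _) (h₄ _)
  have h6 := norm_sq_sum_mul_le h5 (fun t => corr F₁ F₃ t)
  have h7 := sum_norm_sq_corr_le F₃ fun ζ => hξ ζ (Finset.mem_univ _)
  have h8 := sum_norm_sq_le_card h₃
  rw [h1, norm_mul, Complex.norm_real, Real.norm_of_nonneg hN.le] at h
  have h9 : τ * N ^ 2 ≤ ‖∑ k, corr F₂ F₄ k / N * corr F₁ F₃ k‖ := by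
    refine le_of_mul_le_mul_left ?_ hN
    calc _ = τ * N ^ 3 := by ring
      _ ≤ _ := h
  have h10 : (τ * N ^ 2) ^ 2 ≤ N * (‖hat F₁ ξ‖ ^ 2 * N) := by
    calc _ ≤ _ := by gcongr
      _ ≤ _ := h6
      _ ≤ N * (‖hat F₁ ξ‖ ^ 2 * ∑ x, ‖F₃ x‖ ^ 2) := by gcongr
      _ ≤ _ := by gcongr
  refine le_of_sq_le_sq ?_ (norm_nonneg _)
  refine le_of_mul_le_mul_left ?_ (pow_pos hN 2)
  calc _ = (τ * N ^ 2) ^ 2 := by ring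
    _ ≤ _ := h10
    _ = _ := by ring

/-- Detecting `Q x = a` by averaging characters over `η` freezes the argument `Q x` to a constant,
at the price of a linear phase and a factor equal to the number of values of `Q`. -/
lemma exists_fixed_value_twist (Q : F2 n →ₗ[ZMod 2] F2 n) (Φ : F2 n → F2 n → ℂ) {t : ℝ}
    (h : t ≤ ‖∑ x, Φ (Q x) x‖) :
    ∃ a η : F2 n, t ≤ (Finset.univ.image Q).card * ‖∑ x, Φ a x * sgn (η ⬝ᵥ Q x)‖ := by
  have hN := card_F2_pos n
  have hN' : (Fintype.card (F2 n) : ℂ) ≠ 0 := by exact_mod_cast hN.ne'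
  by_contra! hcon
  set R : ℝ := ((Finset.univ.image Q).card : ℝ)
  have hind : ∀ x, ∑ a ∈ Finset.univ.image Q, ∑ η : F2 n,
      sgn (η ⬝ᵥ a) * (Φ a x * sgn (η ⬝ᵥ Q x)) = Fintype.card (F2 n) * Φ (Q x) x := by
    intro x
    have h1 : ∀ a, ∑ η : F2 n, sgn (η ⬝ᵥ a) * (Φ a x * sgn (η ⬝ᵥ Q x)) =
        if Q x = a then Φ a x * Fintype.card (F2 n) else 0 := fun a => by
      have h2 : ∀ η : F2 n, sgn (η ⬝ᵥ a) * (Φ a x * sgn (η ⬝ᵥ Q x)) =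
          Φ a x * sgn (η ⬝ᵥ (Q x + a)) := fun η => by
        rw [dotProduct_add, sgn_add]; ring
      simp only [h2, ← Finset.mul_sum, sum_sgn_dotProduct, ← ZModModule.sub_eq_add, sub_eq_zero]
      split_ifs <;> simp
    simp only [h1]
    rw [Finset.sum_ite_eq, if_pos (Finset.mem_image_of_mem _ (Finset.mem_univ _)), mul_comm]
  have h2 : Fintype.card (F2 n) * ∑ x, Φ (Q x) x = ∑ a ∈ Finset.univ.image Q, ∑ η : F2 n,
      sgn (η ⬝ᵥ a) * ∑ x, Φ a x * sgn (η ⬝ᵥ Q x) := by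
    rw [Finset.mul_sum]
    simp only [← hind, Finset.mul_sum]
    rw [Finset.sum_comm]
    exact Finset.sum_congr rfl fun a _ => Finset.sum_comm
  have h3 := congrArg norm h2
  rw [norm_mul, Complex.norm_natCast] at h3
  have hne : (Finset.univ.image Q).Nonempty := ⟨Q 0, Finset.mem_image_of_mem _ (Finset.mem_univ _)⟩
  have hR : 0 < R := Nat.cast_pos.2 hne.card_pos
  have h4 : ‖∑ a ∈ Finset.univ.image Q, ∑ η : F2 n,
      sgn (η ⬝ᵥ a) * ∑ x, Φ a x * sgn (η ⬝ᵥ Q x)‖ <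
      ∑ a ∈ Finset.univ.image Q, ∑ _η : F2 n, t / R := by
    refine (norm_sum_le _ _).trans_lt (Finset.sum_lt_sum_of_nonempty hne fun a _ => ?_)
    refine (norm_sum_le _ _).trans_lt (Finset.sum_lt_sum_of_nonempty ⟨0, by simp⟩ fun η _ => ?_)
    rw [norm_mul, norm_sgn, one_mul, lt_div_iff₀ hR, mul_comm]
    exact hcon a η
  rw [← h3, Finset.sum_const, Finset.sum_const, nsmul_eq_mul, nsmul_eq_mul, Finset.card_univ] at h4
  have h5 : R * (Fintype.card (F2 n) * (t / R)) = Fintype.card (F2 n) * t := by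
    field_simp
  rw [h5] at h4
  exact absurd (lt_of_mul_lt_mul_left h4 hN.le) (not_lt.2 h)

end Box

/-! ### Reduction to an alternating form and integration to a quadratic phase. -/

section Symmetrization

variable {n : ℕ}

/-- The vectors `x` in the kernel of `B + Bᵀ` with `B(x, x) = 0`. -/
def isotropicKernel (B : F2 n →ₗ[ZMod 2] F2 n →ₗ[ZMod 2] ZMod 2) : Submodule (ZMod 2) (F2 n) :=
  AddSubgroup.toZModSubmodule 2
    { carrier := {x | (B + B.flip) x = 0 ∧ B x x = 0}
      zero_mem' := by simp
      add_mem' := by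
        rintro x y ⟨hx, hx'⟩ ⟨hy, hy'⟩
        refine ⟨by rw [map_add, hx, hy, add_zero], ?_⟩
        have h := LinearMap.congr_fun hx y
        simp only [LinearMap.add_apply, LinearMap.flip_apply, LinearMap.zero_apply] at h
        simp only [map_add, LinearMap.add_apply, hx', hy', zero_add, add_zero]
        rw [add_comm]
        exact h
      neg_mem' := by
        rintro x hx
        rwa [ZModModule.neg_eq_self] }

lemma mem_isotropicKernel {B : F2 n →ₗ[ZMod 2] F2 n →ₗ[ZMod 2] ZMod 2} {x : F2 n} :
    x ∈ isotropicKernel B ↔ (B + B.flip) x = 0 ∧ B x x = 0 := Iff.rfl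

/-- On the kernel of `B + Bᵀ` the cross term of `x ↦ B(x, x)` vanishes, so this map is additive and
its zero set has index at most 2. -/
lemma card_ker_le_two_mul_card_isotropicKernel
    (B : F2 n →ₗ[ZMod 2] F2 n →ₗ[ZMod 2] ZMod 2) :
    (Finset.univ.filter fun x => (B + B.flip) x = 0).card ≤
      2 * Nat.card (isotropicKernel B) := by
  classical
  have hcard : Nat.card (isotropicKernel B) =
      (Finset.univ.filter fun x => (B + B.flip) x = 0 ∧ B x x = 0).card := by
    rw [Nat.card_eq_fintype_card, Fintype.card_subtype]
    simp only [mem_isotropicKernel]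
  have h := Finset.card_filter_add_card_filter_not
    (s := Finset.univ.filter fun x => (B + B.flip) x = 0) (fun x => B x x = 0)
  rw [Finset.filter_filter, Finset.filter_filter, ← hcard] at h
  have hle : (Finset.univ.filter fun x => (B + B.flip) x = 0 ∧ ¬ B x x = 0).card ≤
      Nat.card (isotropicKernel B) := by
    rcases (Finset.univ.filter fun x =>
      (B + B.flip) x = 0 ∧ ¬ B x x = 0).eq_empty_or_nonempty with h0 | ⟨x₀, hx₀⟩
    · rw [h0]; simp
    · rw [hcard]
      refine Finset.card_le_card_of_injOn (fun x => x + x₀) ?_ (fun x _ y _ h => by simpa using h)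
      intro x hx
      simp only [Finset.coe_filter, Finset.mem_univ, true_and, Set.mem_ofPred_eq,
        Finset.mem_filter] at hx hx₀ ⊢
      refine ⟨by rw [map_add, hx.1, hx₀.1, add_zero], ?_⟩
      have h1 := LinearMap.congr_fun hx.1 x₀
      simp only [LinearMap.add_apply, LinearMap.flip_apply, LinearMap.zero_apply] at h1
      have h2 : ∀ a : ZMod 2, a ≠ 0 → a = 1 := by decide
      simp only [map_add, LinearMap.add_apply, h2 _ hx.2, h2 _ hx₀.2]
      grind
  omega

/-- `𝔽₂ⁿ` splits as a subspace plus the image of the complementary projection. -/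
lemma exists_projection (W : Submodule (ZMod 2) (F2 n)) :
    ∃ P Q : F2 n →ₗ[ZMod 2] F2 n, (∀ x, x = P x + Q x) ∧ (∀ x, P x ∈ W) ∧
      (Finset.univ.image Q).card * Nat.card W ≤ Fintype.card (F2 n) := by
  classical
  obtain ⟨p, hp⟩ := LinearMap.exists_extend (LinearMap.id : W →ₗ[ZMod 2] W)
  refine ⟨W.subtype ∘ₗ p, LinearMap.id - W.subtype ∘ₗ p, fun x => by simp,
    fun x => (p x).2, ?_⟩
  set Q : F2 n →ₗ[ZMod 2] F2 n := LinearMap.id - W.subtype ∘ₗ p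
  have hQW : ∀ w : W, Q w = 0 := fun w => by
    have : p w = w := LinearMap.congr_fun hp w
    simp [Q, this]
  -- Idempotence of `Q`, together with its vanishing on `W`, makes the range of `Q` independent of
  -- `W`, which gives the product bound.
  have hQQ : ∀ x, Q (Q x) = Q x := fun x => by
    have : Q x = x - (p x : F2 n) := rfl
    conv_lhs => rw [this, map_sub, hQW, sub_zero]
  rw [Nat.card_eq_fintype_card, ← Finset.card_univ (α := W), ← Finset.card_product]
  refine Finset.card_le_card_of_injOn (fun q => q.1 + q.2) (fun _ _ => Finset.mem_univ _) ?_
  rintro ⟨a, w⟩ h ⟨a', w'⟩ h' e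
  rw [Finset.mem_coe, Finset.mem_product] at h h'
  obtain ⟨x, -, rfl⟩ := Finset.mem_image.1 h.1
  obtain ⟨x', -, rfl⟩ := Finset.mem_image.1 h'.1
  have h1 := congrArg Q e
  simp only [map_add, hQW, hQQ, add_zero] at h1
  simp only [h1, add_right_inj] at e
  exact Prod.ext h1 (Subtype.ext e)

/-- Since `B` polarises `q`, the value `B(h, k)` is the sum of `q` over the vertices `x`, `x + h`,
`x + k`, `x + h + k`. A linear term in `h` or `k` is likewise a sum over the two ends of an edge, so
each phase distributes over the four functions. -/
lemma boxSum_absorb (f₁ f₂ f₃ f₄ : F2 n → ℂ) {B : F2 n →ₗ[ZMod 2] F2 n →ₗ[ZMod 2] ZMod 2}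
    {q : F2 n → ZMod 2} (hq : ∀ x y, q (x + y) = q x + q y + B x y)
    (l m : F2 n →ₗ[ZMod 2] ZMod 2) :
    boxSum (fun h k => B h k + l h + m k) f₁ f₂ f₃ f₄ =
      boxSum (fun _ _ => 0) (fun x => f₁ x * sgn (q x + l x + m x))
        (fun x => f₂ x * sgn (q x + l x)) (fun x => f₃ x * sgn (q x + m x))
        (fun x => f₄ x * sgn (q x)) := by
  refine Finset.sum_congr rfl fun h _ => Finset.sum_congr rfl fun k _ =>
    Finset.sum_congr rfl fun x _ => ?_
  have : B h k + l h + m k = (q x + l x + m x) + (q (x + h) + l (x + h)) +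
      (q (x + k) + m (x + k)) + q (x + h + k) := by
    simp only [hq, map_add, LinearMap.add_apply]
    grind
  beta_reduce
  rw [this, sgn_add, sgn_add, sgn_add, sgn_zero]
  ring

/-- Splitting along `P` and `Q`, every term of `B(h, k)` other than `B(P h, P k)` involves `Q h` or
`Q k` and becomes linear once that value is frozen. Freezing both costs the square of the number of
values of `Q`. -/
lemma exists_linear_twist {f₁ f₂ f₃ f₄ : F2 n → ℂ} (B : F2 n →ₗ[ZMod 2] F2 n →ₗ[ZMod 2] ZMod 2)
    {P Q : F2 n →ₗ[ZMod 2] F2 n} (hPQ : ∀ x, x = P x + Q x) :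
    ∃ l m : F2 n →ₗ[ZMod 2] ZMod 2, ‖boxSum (fun h k => B h k) f₁ f₂ f₃ f₄‖ ≤
      (Finset.univ.image Q).card ^ 2 *
        ‖boxSum (fun h k => B.compl₁₂ P P h k + l h + m k) f₁ f₂ f₃ f₄‖ := by
  have hB : ∀ h k, B h k = B (P h) (P k) + B (Q h) k + B (P h) (Q k) := fun h k => by
    have e1 : B h k = B (P h) k + B (Q h) k := by
      rw [← LinearMap.add_apply, ← map_add, ← hPQ]
    have e2 : B (P h) k = B (P h) (P k) + B (P h) (Q k) := by
      rw [← map_add, ← hPQ]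
    rw [e1, e2]
    ring
  let dot : F2 n → F2 n →ₗ[ZMod 2] ZMod 2 := fun η => dotProductBilin (ZMod 2) (ZMod 2) η
  have hdot : ∀ η x, dot η x = η ⬝ᵥ x := fun _ _ => rfl
  let T : F2 n → F2 n → F2 n → ℂ := fun h k x => f₁ x * f₂ (x + h) * f₃ (x + k) * f₄ (x + h + k)
  obtain ⟨a, η, h1⟩ := exists_fixed_value_twist Q
    (fun a h => ∑ k, ∑ x, T h k x * sgn (B (P h) (P k) + B a k + B (P h) (Q k))) le_rfl
  obtain ⟨b, ζ, h2⟩ := exists_fixed_value_twist Q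
    (fun b k => ∑ h, ∑ x, T h k x * sgn (B (P h) (P k) + B a k + B (P h) b) * sgn (η ⬝ᵥ Q h))
    le_rfl
  refine ⟨B.flip b ∘ₗ P + dot η ∘ₗ Q, B a + dot ζ ∘ₗ Q, ?_⟩
  have e1 : boxSum (fun h k => B h k) f₁ f₂ f₃ f₄ =
      ∑ h, ∑ k, ∑ x, T h k x * sgn (B (P h) (P k) + B (Q h) k + B (P h) (Q k)) := by
    simp only [boxSum, ← hB, T]
  have e2 : ∑ h, (∑ k, ∑ x, T h k x * sgn (B (P h) (P k) + B a k + B (P h) (Q k))) *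
      sgn (η ⬝ᵥ Q h) = ∑ k, ∑ h, ∑ x,
        T h k x * sgn (B (P h) (P k) + B a k + B (P h) (Q k)) * sgn (η ⬝ᵥ Q h) := by
    simp only [Finset.sum_mul]
    exact Finset.sum_comm
  have e3 : ∑ k, (∑ h, ∑ x, T h k x * sgn (B (P h) (P k) + B a k + B (P h) b) *
      sgn (η ⬝ᵥ Q h)) * sgn (ζ ⬝ᵥ Q k) =
      boxSum (fun h k => B.compl₁₂ P P h k + (B.flip b ∘ₗ P + dot η ∘ₗ Q) h +
        (B a + dot ζ ∘ₗ Q) k) f₁ f₂ f₃ f₄ := by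
    simp only [Finset.sum_mul, boxSum]
    rw [Finset.sum_comm]
    refine Finset.sum_congr rfl fun h _ => Finset.sum_congr rfl fun k _ =>
      Finset.sum_congr rfl fun x _ => ?_
    simp only [LinearMap.compl₁₂_apply, LinearMap.add_apply, LinearMap.comp_apply,
      LinearMap.flip_apply, hdot, sgn_add, T]
    ring
  rw [e2] at h1
  rw [e3] at h2
  rw [e1, sq, mul_assoc]
  exact h1.trans (mul_le_mul_of_nonneg_left h2 (Nat.cast_nonneg _))

/-- A function whose derivatives correlate with a linear family of characters correlates with a
quadratic phase. -/
theorem exists_quadratic_of_sum_norm_sq_hat {f : F2 n → ℂ} (hf : ∀ x, ‖f x‖ ≤ 1)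
    (M : F2 n →ₗ[ZMod 2] F2 n) (η : F2 n) {ρ : ℝ} (hρ : 0 < ρ)
    (h : ρ * (Fintype.card (F2 n) : ℝ) ^ 3 ≤ ∑ h, ‖hat (mderiv f h) (M h + η)‖ ^ 2) :
    ∃ ψ : F2 n → ZMod 2, IsQuadraticPolynomial ψ ∧
      ρ ^ 5 / 4 * Fintype.card (F2 n) ≤ ‖∑ x, f x * sgn (ψ x)‖ := by
  classical
  have hN := card_F2_pos n
  set N : ℝ := (Fintype.card (F2 n) : ℝ) with hNdef
  let dot : F2 n → F2 n →ₗ[ZMod 2] ZMod 2 := fun η => dotProductBilin (ZMod 2) (ZMod 2) η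
  let B : F2 n →ₗ[ZMod 2] F2 n →ₗ[ZMod 2] ZMod 2 := dotProductBilin (ZMod 2) (ZMod 2) ∘ₗ M
  have hbox : ρ * N ^ 3 ≤ ‖boxSum (fun h k => B h k) (fun x => f x * sgn (η ⬝ᵥ x))
      (fun x => conj (f x)) (fun x => conj (f x) * sgn (η ⬝ᵥ x)) f‖ := by
    refine h.trans ?_
    have := sum_norm_sq_hat_mderiv_eq_boxSum f M η
    refine le_trans (le_of_eq ?_) (le_of_eq (congrArg norm this))
    rw [Complex.norm_real, Real.norm_of_nonneg (by positivity)]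
  have hf' : ∀ x, ‖conj (f x)‖ ≤ 1 := by simpa using hf
  have hker := card_ker_ge_of_boxSum (norm_mul_sgn_le hf _) hf' (norm_mul_sgn_le hf' _) hf
    hρ.le hbox
  have hW := card_ker_le_two_mul_card_isotropicKernel B
  -- Since `P` takes values where `B(x, x) = 0`, the form `B(P x, P y)` is alternating; and the
  -- range of `Q` is small because the isotropic kernel is large.
  obtain ⟨P, Q, hPQ, hPW, hR⟩ := exists_projection (isotropicKernel B)
  obtain ⟨l, m, hlm⟩ := exists_linear_twist (f₁ := fun x => f x * sgn (η ⬝ᵥ x))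
    (f₂ := fun x => conj (f x)) (f₃ := fun x => conj (f x) * sgn (η ⬝ᵥ x)) (f₄ := f) B hPQ
  obtain ⟨q, hq⟩ := exists_quadratic_of_alternating (B := B.compl₁₂ P P)
    (fun x => (mem_isotropicKernel.1 (hPW x)).2)
  rw [boxSum_absorb _ _ _ _ hq] at hlm
  set R : ℝ := ((Finset.univ.image Q).card : ℝ)
  have hR0 : 0 < R :=
    Nat.cast_pos.2 (Finset.card_pos.2 ⟨Q 0, Finset.mem_image_of_mem _ (Finset.mem_univ _)⟩)
  have h2 : R * Nat.card (isotropicKernel B) ≤ N := by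
    rw [hNdef]; simp only [R]; exact_mod_cast hR
  clear_value R
  have hRle : R * ρ ^ 2 ≤ 2 := by
    have h1 : ρ ^ 2 * N ≤ 2 * Nat.card (isotropicKernel B) := hker.trans (by exact_mod_cast hW)
    refine le_of_mul_le_mul_right ?_ hN
    calc R * ρ ^ 2 * N = R * (ρ ^ 2 * N) := by ring
      _ ≤ R * (2 * Nat.card (isotropicKernel B)) := by gcongr
      _ = 2 * (R * Nat.card (isotropicKernel B)) := by ring
      _ ≤ 2 * N := by gcongr
  -- The linear twists cost `R ^ 2`, and `R ≤ 2 / ρ ^ 2`; this is the origin of `ρ ^ 5 / 4`.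
  have hτ : ρ ^ 5 / 4 * R ^ 2 ≤ ρ := by
    calc ρ ^ 5 / 4 * R ^ 2 = ρ / 4 * (R * ρ ^ 2) ^ 2 := by ring
      _ ≤ ρ / 4 * 2 ^ 2 := by gcongr
      _ = ρ := by ring
  obtain ⟨ξ, hξ⟩ := exists_hat_ge_of_boxSum (τ := ρ ^ 5 / 4)
    (F₁ := fun x => f x * sgn (η ⬝ᵥ x) * sgn (q x + l x + m x))
    (F₂ := fun x => conj (f x) * sgn (q x + l x))
    (F₃ := fun x => conj (f x) * sgn (η ⬝ᵥ x) * sgn (q x + m x))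
    (F₄ := fun x => f x * sgn (q x)) (norm_mul_sgn_le hf' _)
    (norm_mul_sgn_le (norm_mul_sgn_le hf' _) _) (norm_mul_sgn_le hf _) (by positivity) (by
      refine le_of_mul_le_mul_left ?_ (pow_pos hR0 2)
      calc R ^ 2 * (ρ ^ 5 / 4 * N ^ 3) = ρ ^ 5 / 4 * R ^ 2 * N ^ 3 := by ring
        _ ≤ ρ * N ^ 3 := by gcongr
        _ ≤ _ := hbox.trans hlm)
  refine ⟨fun x => q x + (dot η + l + m + dot ξ) x, ?_, ?_⟩
  · refine isQuadraticPolynomial_of_polarization (B := B.compl₁₂ P P) fun x y => ?_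
    simp only [hq, map_add]
    ring
  · refine hξ.trans (le_of_eq ?_)
    congr 1
    refine Finset.sum_congr rfl fun x _ => ?_
    have e : ∀ ζ, dot ζ x = ζ ⬝ᵥ x := fun _ => rfl
    simp only [LinearMap.add_apply, sgn_add, e]
    ring

end Symmetrization

/-! ### Freiman–Ruzsa implies the inverse theorem. -/

/-- The polynomial inverse statement for the `U³` norm over `𝔽₂ⁿ` with exponent `C`. -/
def PolynomialInverseU3 (C : ℝ) : Prop :=
  ∀ K : ℝ, 2 ≤ K → ∀ (n : ℕ) (f : (Fin n → ZMod 2) → ℂ), IsApproxQuadratic K f →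
    ∃ ψ : (Fin n → ZMod 2) → ZMod 2, IsQuadraticPolynomial ψ ∧
      Correlates (K ^ (-C)) f (signPhase ψ)

lemma correlates_signPhase_iff {n : ℕ} {δ : ℝ} {f : F2 n → ℂ} {ψ : F2 n → ZMod 2} :
    Correlates δ f (signPhase ψ) ↔ δ * Fintype.card (F2 n) ≤ ‖∑ x, f x * sgn (ψ x)‖ := by
  have h : ∀ x, conj (signPhase ψ x) = sgn (ψ x) := fun x => conj_sgn (ψ x)
  rw [Correlates, Fintype.expect_eq_sum_div_card, norm_div, Complex.norm_natCast,
    le_div_iff₀ (card_F2_pos n)]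
  simp only [h]

/-- The large Fourier coefficients of the derivatives of an approximate quadratic contain a graph
of small doubling. -/
lemma exists_small_doubling_graph {n : ℕ} {f : F2 n → ℂ} {K : ℝ} (hK : 2 ≤ K)
    (hf : IsApproxQuadratic K f) :
    ∃ (S : Finset (F2 n)) (ξ : F2 n → F2 n) (A : Finset (F2 n × F2 n)),
      (∀ h ∈ S, (1 / K) ^ 9 * (Fintype.card (F2 n) : ℝ) ^ 2 ≤ ‖hat (mderiv f h) (ξ h)‖ ^ 2) ∧
      A ⊆ graphOver S ξ ∧ (Fintype.card (F2 n) : ℝ) ≤ K ^ 38 * A.card ∧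
      ((A + A).card : ℝ) ≤ K ^ 159 * A.card := by
  have hK0 : 0 < K := by linarith
  have hN := card_F2_pos n
  set N : ℝ := (Fintype.card (F2 n) : ℝ) with hNdef
  obtain ⟨S, ξ, hS, hE⟩ := exists_energy_ge hf.1 (by positivity)
    (sum_gowersU2Sum_mderiv_ge hK0 hf)
  -- As `K ≥ 2`, numerical constants are absorbed into powers of `K`: here a factor 2, below `8 / 3
  -- ≤ K ^ 2` and `4356 ≤ K ^ 13`. The exponents are `36 = 4 * 9`, `38 = 36 + 2` and `159 = 13 + 3 *
  -- 36 + 38`.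
  have hδ : (1 / K) ^ 9 ≤ (1 / K) ^ 8 / 2 := by
    rw [pow_succ, div_eq_mul_inv _ (2 : ℝ), one_div K]
    gcongr
  have hcard : ((graphOver S ξ).card : ℝ) ≤ N := by
    rw [card_graphOver, hNdef]
    exact_mod_cast Finset.card_le_univ _
  have hκ : (1 / K) ^ 36 * N ^ 3 ≤ ∑ z, ((popularFiber (graphOver S ξ) z).card : ℝ) ^ 2 := by
    refine le_trans ?_ hE
    gcongr
    calc (1 / K) ^ 36 = ((1 / K) ^ 9) ^ 4 := by ring
      _ ≤ _ := by gcongr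
  obtain ⟨A, hA, hA1, hA2⟩ := balog_szemeredi_gowers (graphOver S ξ) hN
    (κ := (1 / K) ^ 36) (by positivity) hcard hκ
  have hsub : A - A = A + A := by
    ext x
    simp only [Finset.mem_sub, Finset.mem_add, ZModModule.sub_eq_add]
  have hN1 : N ≤ K ^ 38 * A.card := by
    have h2 : K ^ 38 * (3 / 8 * (1 / K) ^ 36 * N) ≤ K ^ 38 * A.card := by gcongr
    have h3 : K ^ 38 * (3 / 8 * (1 / K) ^ 36 * N) = 3 / 8 * K ^ 2 * N := by
      field_simp
    have h4 : 1 ≤ 3 / 8 * K ^ 2 := by nlinarith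
    nlinarith
  refine ⟨S, ξ, A, fun h hh => le_trans (by gcongr) (hS h hh), hA, hN1, ?_⟩
  rw [hsub] at hA2
  have h5 : (4356 : ℝ) ≤ K ^ 13 := by
    calc (4356 : ℝ) ≤ 2 ^ 13 := by norm_num
      _ ≤ _ := by gcongr
  calc _ ≤ _ := hA2
    _ = 4356 * K ^ 108 * N := by
        rw [one_div, inv_pow, inv_pow, div_inv_eq_mul, ← pow_mul]
    _ ≤ K ^ 13 * K ^ 108 * (K ^ 38 * A.card) := by gcongr
    _ = _ := by ring

theorem polynomialInverseU3_of_polynomialFreimanRuzsa {C : ℝ} (hC : PolynomialFreimanRuzsa C) :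
    ∃ C' : ℝ, 0 < C' ∧ PolynomialInverseU3 C' := by
  classical
  set m : ℕ := ⌈C⌉₊
  -- With doubling `K ^ 159`, the control constant is at most `K ^ (795 * m)`, where `795 = 5 *
  -- 159`. The density loss has exponent `206 + 2385 * m`, with `206 = 9 + 38 + 159` and `2385 = 3 *
  -- 795`. Passing to `ρ ^ 5 / 4` multiplies this by 5 and adds 2.
  refine ⟨(1032 + 11925 * m : ℕ), by positivity, fun K hK n f hf => ?_⟩
  have hK0 : 0 < K := by linarith
  have hK1 : 1 ≤ K := by linarith
  have hN := card_F2_pos n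
  set N : ℝ := (Fintype.card (F2 n) : ℝ)
  obtain ⟨S, ξ, A, hS, hA, hNA, hAA⟩ := exists_small_doubling_graph hK hf
  have hA0 : (0 : ℝ) < A.card := pos_of_mul_pos_right (hN.trans_le hNA) (by positivity)
  have hL : 2 ≤ K ^ 159 := hK.trans (le_self_pow₀ hK1 (by norm_num))
  obtain ⟨H, A', a₀, hA'A, hH, hHcard, hA'⟩ := exists_subgroup_of_small_doubling hC
    (Finset.card_pos.1 (by exact_mod_cast hA0)) hL hAA
  set P : ℝ := K ^ (795 * m)
  have hP : ((K ^ 159) ^ 5) ^ C ≤ P := by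
    calc ((K ^ 159) ^ 5) ^ C ≤ ((K ^ 159) ^ 5) ^ (m : ℝ) :=
          Real.rpow_le_rpow_of_exponent_le (one_le_pow₀ (by linarith)) (Nat.le_ceil C)
      _ = P := by
          rw [Real.rpow_natCast, ← pow_mul, ← pow_mul]
          simp only [P]
          congr 1
          ring
  have hP0 : 0 < P := by positivity
  obtain ⟨M, η, hM⟩ := exists_linearMap_of_graphOver H (hA'A.trans hA) hH
  set T := S.filter fun h => ξ h = M h + η
  have hT : N ≤ K ^ 38 * (P ^ 3 * K ^ 159 * T.card) := by
    refine hNA.trans ?_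
    gcongr
    refine le_of_mul_le_mul_left ?_ hA0
    calc (A.card : ℝ) * A.card ≤ (P * A'.card) * (P * A'.card) := by
          have : (A.card : ℝ) ≤ P * A'.card := hA'.trans (by gcongr)
          gcongr
      _ = P ^ 2 * (A'.card : ℝ) ^ 2 := by ring
      _ ≤ P ^ 2 * (Nat.card H * T.card) := by gcongr
      _ ≤ P ^ 2 * (P * (K ^ 159 * A.card) * T.card) := by
          gcongr
          exact hHcard.trans (by gcongr)
      _ = _ := by ring
  set ρ : ℝ := (1 / K) ^ (206 + 2385 * m)
  have hsum : ρ * N ^ 3 ≤ ∑ h, ‖hat (mderiv f h) (M h + η)‖ ^ 2 := by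
    calc ρ * N ^ 3 ≤ ρ * (K ^ 38 * (P ^ 3 * K ^ 159 * T.card) * N ^ 2) := by
          rw [pow_succ N 2, mul_comm (N ^ 2)]
          gcongr
      _ = T.card * ((1 / K) ^ 9 * N ^ 2) := by
          have : ρ * (K ^ 38 * (P ^ 3 * K ^ 159)) = (1 / K) ^ 9 := by
            simp only [ρ, P, one_div, inv_pow]
            rw [inv_mul_eq_iff_eq_mul₀ (by positivity), eq_mul_inv_iff_mul_eq₀ (by positivity)]
            ring
          rw [← this]
          ring
      _ = ∑ h ∈ T, ((1 / K) ^ 9 * N ^ 2) := by rw [Finset.sum_const, nsmul_eq_mul]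
      _ ≤ ∑ h ∈ T, ‖hat (mderiv f h) (M h + η)‖ ^ 2 := by
          refine Finset.sum_le_sum fun h hh => ?_
          obtain ⟨h1, h2⟩ := Finset.mem_filter.1 hh
          rw [← h2]
          exact hS h h1
      _ ≤ _ := Finset.sum_le_univ_sum_of_nonneg fun _ => by positivity
  obtain ⟨ψ, hψ, hcor⟩ := exists_quadratic_of_sum_norm_sq_hat hf.1 M η (by positivity) hsum
  refine ⟨ψ, hψ, correlates_signPhase_iff.2 (le_trans ?_ hcor)⟩
  gcongr
  rw [Real.rpow_neg hK0.le, Real.rpow_natCast, ← inv_pow, ← one_div,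
    show 1032 + 11925 * m = (206 + 2385 * m) * 5 + 2 by ring, pow_add, pow_mul]
  have h4 : (1 / K) ^ 2 ≤ 1 / 4 := by
    rw [one_div, inv_pow, one_div]
    gcongr
    nlinarith
  calc _ ≤ ((1 / K) ^ (206 + 2385 * m)) ^ 5 * (1 / 4) := by gcongr
    _ = _ := by ring

/-! ### A small linear model of a set. -/

section Model

/-- Choose `V` maximal among the subspaces that meet `T` only in 0. If the coset `w + V` missed `T`,
then `w` could be adjoined to `V`. -/
lemma exists_maximal_avoiding {d : ℕ} {T : Finset (F2 d)} (h0 : (0 : F2 d) ∈ T) :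
    ∃ V : Submodule (ZMod 2) (F2 d), (∀ v ∈ V, v ∈ T → v = 0) ∧
      ∀ w, ∃ v ∈ V, w + v ∈ T := by
  obtain ⟨V, hV⟩ := Set.Finite.exists_maximal
    (s := {V : Submodule (ZMod 2) (F2 d) | ∀ v ∈ V, v ∈ T → v = 0}) (Set.toFinite _)
    ⟨⊥, fun v hv _ => (Submodule.mem_bot _).1 hv⟩
  refine ⟨V, hV.prop, fun w => ?_⟩
  by_contra! hcon
  have hle : V ⊔ Submodule.span (ZMod 2) {w} ≤ V := by
    refine hV.le_of_ge ?_ le_sup_left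
    intro u hu huT
    obtain ⟨v, hv, s, hs, rfl⟩ := Submodule.mem_sup.1 hu
    obtain ⟨c, rfl⟩ := Submodule.mem_span_singleton.1 hs
    have hc : ∀ c : ZMod 2, c = 0 ∨ c = 1 := by decide
    rcases hc c with rfl | rfl
    · rw [zero_smul, add_zero] at huT ⊢
      exact hV.prop v hv huT
    · rw [one_smul, add_comm] at huT
      exact absurd huT (hcon v hv)
  have hw : w ∈ V := hle (Submodule.mem_sup_right (Submodule.mem_span_singleton_self w))
  refine hcon w hw ?_
  rwa [ZModModule.add_self]

/-- A linear map to a space no larger than `T` whose kernel meets `T` trivially. -/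
lemma exists_small_model {d : ℕ} {T : Finset (F2 d)} (h0 : (0 : F2 d) ∈ T) :
    ∃ (m : ℕ) (π : F2 d →ₗ[ZMod 2] F2 m), Fintype.card (F2 m) ≤ T.card ∧
      ∀ v ∈ T, π v = 0 → v = 0 := by
  classical
  obtain ⟨V, hV, hsurj⟩ := exists_maximal_avoiding h0
  let b := Module.finBasis (ZMod 2) (F2 d ⧸ V)
  refine ⟨_, b.equivFun.toLinearMap ∘ₗ V.mkQ, ?_, fun v hv h => ?_⟩
  · have h1 : Nat.card (F2 d) ≤ T.card * Nat.card V := by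
      rw [show T.card = Nat.card T by simp, ← Nat.card_prod]
      refine Nat.card_le_card_of_surjective
        (fun p : T × V => (p.1 : F2 d) + p.2) fun w => ?_
      obtain ⟨v, hv, hw⟩ := hsurj w
      refine ⟨(⟨w + v, hw⟩, ⟨v, hv⟩), ?_⟩
      simp only [add_assoc, ZModModule.add_self, add_zero]
    rw [Submodule.card_eq_card_quotient_mul_card V, Nat.card_congr b.equivFun.toEquiv,
      Nat.card_eq_fintype_card (α := F2 (Module.finrank (ZMod 2) (F2 d ⧸ V)))] at h1
    exact Nat.le_of_mul_le_mul_left (by linarith) (Nat.card_pos (α := V))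
  · refine hV v ?_ hv
    have : V.mkQ v = 0 := b.equivFun.injective (by simpa using h)
    simpa using this

end Model

/-! ### Invariance of the `U³` average and its lower bound by the mean. -/

section Average

lemma gowersU3Average_comp_addEquiv {G G' : Type*} [AddCommGroup G] [Fintype G] [AddCommGroup G']
    [Fintype G'] (e : G ≃+ G') (f : G' → ℂ) :
    gowersU3Average (fun x => f (e x)) = gowersU3Average f := by
  simp only [gowersU3Average]
  refine Fintype.expect_equiv e.toEquiv _ _ fun x => Fintype.expect_equiv e.toEquiv _ _ fun h₁ =>
    Fintype.expect_equiv e.toEquiv _ _ fun h₂ => Fintype.expect_equiv e.toEquiv _ _ fun h₃ => ?_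
  simp

lemma expect_prod_fst {α β : Type*} [Fintype α] [Fintype β] [Nonempty β] (F : α → ℂ) :
    𝔼 p : α × β, F p.1 = 𝔼 x, F x := by
  have hβ : (Fintype.card β : ℂ) ≠ 0 := by exact_mod_cast Fintype.card_ne_zero
  rw [Fintype.expect_eq_sum_div_card, Fintype.expect_eq_sum_div_card, Fintype.sum_prod_type]
  simp only [Finset.sum_const, Finset.card_univ, nsmul_eq_mul, Fintype.card_prod, Nat.cast_mul]
  rw [← Finset.mul_sum, mul_comm (Fintype.card α : ℂ), mul_div_mul_left _ _ hβ]

lemma gowersU3Average_comp_fst {G G' : Type*} [AddCommGroup G] [Fintype G] [AddCommGroup G']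
    [Fintype G'] (f : G → ℂ) :
    gowersU3Average (fun p : G × G' => f p.1) = gowersU3Average f := by
  simp only [gowersU3Average, Prod.fst_add]
  have h3 : ∀ x h₁ h₂ : G, 𝔼 h₃ : G × G', f x * conj (f (x + h₁)) * conj (f (x + h₂)) *
      conj (f (x + h₃.1)) * f (x + h₁ + h₂) * f (x + h₁ + h₃.1) * f (x + h₂ + h₃.1) *
      conj (f (x + h₁ + h₂ + h₃.1)) = _ := fun x h₁ h₂ => expect_prod_fst (β := G') fun h₃ =>
    f x * conj (f (x + h₁)) * conj (f (x + h₂)) * conj (f (x + h₃)) *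
      f (x + h₁ + h₂) * f (x + h₁ + h₃) * f (x + h₂ + h₃) * conj (f (x + h₁ + h₂ + h₃))
  simp only [h3]
  have h2 := fun x h₁ : G => expect_prod_fst (β := G') fun h₂ : G => 𝔼 h₃ : G,
    f x * conj (f (x + h₁)) * conj (f (x + h₂)) * conj (f (x + h₃)) *
      f (x + h₁ + h₂) * f (x + h₁ + h₃) * f (x + h₂ + h₃) * conj (f (x + h₁ + h₂ + h₃))
  simp only [h2]
  have h1 := fun x : G => expect_prod_fst (β := G') fun h₁ : G => 𝔼 h₂ : G, 𝔼 h₃ : G,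
    f x * conj (f (x + h₁)) * conj (f (x + h₂)) * conj (f (x + h₃)) *
      f (x + h₁ + h₂) * f (x + h₁ + h₃) * f (x + h₂ + h₃) * conj (f (x + h₁ + h₂ + h₃))
  simp only [h1]
  exact expect_prod_fst (β := G') fun x : G => 𝔼 h₁ : G, 𝔼 h₂ : G, 𝔼 h₃ : G,
    f x * conj (f (x + h₁)) * conj (f (x + h₂)) * conj (f (x + h₃)) *
      f (x + h₁ + h₂) * f (x + h₁ + h₃) * f (x + h₂ + h₃) * conj (f (x + h₁ + h₂ + h₃))

lemma sq_expect_le {ι : Type*} [Fintype ι] [Nonempty ι] (a : ι → ℝ) :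
    (𝔼 i, a i) ^ 2 ≤ 𝔼 i, a i ^ 2 := by
  have h : (0 : ℝ) < Fintype.card ι := by exact_mod_cast Fintype.card_pos
  rw [Fintype.expect_eq_sum_div_card, Fintype.expect_eq_sum_div_card, div_pow,
    div_le_div_iff₀ (by positivity) h]
  have := sq_sum_le_card_mul_sum_sq (s := Finset.univ) (f := a)
  rw [Finset.card_univ] at this
  nlinarith

/-- The `U³` norm of a real function dominates its mean. -/
lemma expect_pow_eight_le_gowersU3Average {G : Type*} [AddCommGroup G] [Fintype G] (g : G → ℝ) :
    (𝔼 x, g x) ^ 8 ≤ (gowersU3Average fun x => (g x : ℂ)).re := by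
  rw [gowersU3Average_eq, Complex.ofReal_re]
  have h1 : ∀ h₁ h₂ : G, ‖𝔼 x : G, (g x : ℂ) * conj (g (x + h₁) : ℂ) * conj (g (x + h₂) : ℂ) *
      (g (x + h₁ + h₂) : ℂ)‖ ^ 2 = (𝔼 x, g x * g (x + h₁) * g (x + h₂) * g (x + h₁ + h₂)) ^ 2 := by
    intro h₁ h₂
    simp only [Complex.conj_ofReal, ← Complex.ofReal_mul, ← Complex.ofReal_expect]
    rw [Complex.norm_real, Real.norm_eq_abs, sq_abs]
  simp only [h1]
  have shift : ∀ (F : G → G → ℝ), 𝔼 h, 𝔼 x, F x (x + h) = 𝔼 x, 𝔼 y, F x y := fun F => by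
    rw [Finset.expect_comm]
    exact Finset.expect_congr rfl fun x _ =>
      Fintype.expect_equiv (Equiv.addLeft x) _ _ fun h => rfl
  have h2 : (𝔼 x, g x) ^ 2 = 𝔼 h, 𝔼 x, g x * g (x + h) := by
    rw [shift fun x y => g x * g y, sq, Finset.expect_mul_expect]
  have h3 : 𝔼 h₁, (𝔼 x, g x * g (x + h₁)) ^ 2 =
      𝔼 h₁, 𝔼 h₂, 𝔼 x, g x * g (x + h₁) * g (x + h₂) * g (x + h₁ + h₂) := by
    refine Finset.expect_congr rfl fun h₁ _ => ?_
    have : ∀ x h₂, g x * g (x + h₁) * g (x + h₂) * g (x + h₁ + h₂) =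
        (fun x y => (g x * g (x + h₁)) * (g y * g (y + h₁))) x (x + h₂) := fun x h₂ => by
      simp only [add_right_comm x h₁ h₂]; ring
    simp only [this]
    rw [shift fun x y => (g x * g (x + h₁)) * (g y * g (y + h₁)), sq, Finset.expect_mul_expect]
  -- Each squaring doubles the number of variables by a shift, and Cauchy–Schwarz moves the next
  -- square inside the average.
  calc (𝔼 x, g x) ^ 8 = (((𝔼 x, g x) ^ 2) ^ 2) ^ 2 := by ring
    _ ≤ (𝔼 h₁, (𝔼 x, g x * g (x + h₁)) ^ 2) ^ 2 := by
        rw [h2]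
        gcongr
        exact sq_expect_le _
    _ ≤ 𝔼 h₁, (𝔼 h₂, 𝔼 x, g x * g (x + h₁) * g (x + h₂) * g (x + h₁ + h₂)) ^ 2 := by
        rw [h3]
        exact sq_expect_le _
    _ ≤ _ := Finset.expect_le_expect fun h₁ _ => sq_expect_le _

end Average

/-! ### The quadratic phase attached to a Freiman homomorphism. -/

section FreimanPhase

variable {m d : ℕ}

/-- The phase `(x, y) ↦ 1_E(x) (-1)^{φ(x) · y}`. -/
noncomputable def freimanPhase (E : Finset (F2 m)) (φ : F2 m → F2 d) (p : F2 m × F2 d) : ℂ :=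
  if p.1 ∈ E then sgn (φ p.1 ⬝ᵥ p.2) else 0

lemma norm_freimanPhase_le (E : Finset (F2 m)) (φ : F2 m → F2 d) (p : F2 m × F2 d) :
    ‖freimanPhase E φ p‖ ≤ 1 := by
  rw [freimanPhase]
  split_ifs <;> simp

/-- The indicator function of a finite set. -/
noncomputable def ind (E : Finset (F2 m)) (x : F2 m) : ℝ := if x ∈ E then 1 else 0

/-- On a parallelepiped inside `E`, `φ` behaves like an affine map, so `φ(x) · y` behaves like a
quadratic polynomial and its alternating sum over the eight vertices vanishes. On any other
parallelepiped both sides are 0. -/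
lemma gowersU3Average_freimanPhase {E : Finset (F2 m)} {φ : F2 m → F2 d}
    (hφ : ∀ x ∈ E, ∀ y ∈ E, ∀ z ∈ E, ∀ w ∈ E, w = x + y + z → φ w = φ x + φ y + φ z) :
    gowersU3Average (freimanPhase E φ) = gowersU3Average (fun x => (ind E x : ℂ)) := by
  rw [← gowersU3Average_comp_fst (G' := F2 d) (fun x => (ind E x : ℂ))]
  simp only [gowersU3Average]
  refine Finset.expect_congr rfl fun p _ => Finset.expect_congr rfl fun p₁ _ =>
    Finset.expect_congr rfl fun p₂ _ => Finset.expect_congr rfl fun p₃ _ => ?_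
  obtain ⟨x, y⟩ := p
  obtain ⟨h₁, k₁⟩ := p₁
  obtain ⟨h₂, k₂⟩ := p₂
  obtain ⟨h₃, k₃⟩ := p₃
  simp only [freimanPhase, ind, Prod.mk_add_mk]
  by_cases h : x ∈ E ∧ x + h₁ ∈ E ∧ x + h₂ ∈ E ∧ x + h₃ ∈ E ∧ x + h₁ + h₂ ∈ E ∧
      x + h₁ + h₃ ∈ E ∧ x + h₂ + h₃ ∈ E ∧ x + h₁ + h₂ + h₃ ∈ E
  · obtain ⟨i0, i1, i2, i3, i12, i13, i23, i123⟩ := h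
    have e12 := hφ _ i0 _ i1 _ i2 _ i12 (by ext i; simp only [Pi.add_apply]; grind)
    have e13 := hφ _ i0 _ i1 _ i3 _ i13 (by ext i; simp only [Pi.add_apply]; grind)
    have e23 := hφ _ i0 _ i2 _ i3 _ i23 (by ext i; simp only [Pi.add_apply]; grind)
    have e123 := hφ _ i1 _ i12 _ i13 _ i123 (by ext i; simp only [Pi.add_apply]; grind)
    simp only [if_pos, i0, i1, i2, i3, i12, i13, i23, i123, conj_sgn, ← sgn_add]
    have : φ x ⬝ᵥ y + φ (x + h₁) ⬝ᵥ (y + k₁) + φ (x + h₂) ⬝ᵥ (y + k₂) + φ (x + h₃) ⬝ᵥ (y + k₃) +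
        φ (x + h₁ + h₂) ⬝ᵥ (y + k₁ + k₂) + φ (x + h₁ + h₃) ⬝ᵥ (y + k₁ + k₃) +
        φ (x + h₂ + h₃) ⬝ᵥ (y + k₂ + k₃) + φ (x + h₁ + h₂ + h₃) ⬝ᵥ (y + k₁ + k₂ + k₃) = 0 := by
      rw [e123, e12, e13, e23]
      simp only [dotProduct_add, add_dotProduct]
      grind
    rw [this]
    simp
  · simp only [not_and_or] at h
    rcases h with h | h | h | h | h | h | h | h <;> simp [h]

end FreimanPhase

lemma IsQuadraticPolynomial.comp_addMonoidHom {G G' H : Type*} [AddCommGroup G] [AddCommGroup G']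
    [AddCommGroup H] {ψ : G' → H} (hψ : IsQuadraticPolynomial ψ) (e : G →+ G') :
    IsQuadraticPolynomial fun x => ψ (e x) := by
  intro a b c x
  simpa [fwdDiff] using hψ (e a) (e b) (e c) (e x)

/-! ### Extracting a linear map from a correlating quadratic. -/

section Product

variable {m d : ℕ}

/-- A quadratic polynomial on a product is a bilinear form plus functions of one variable. -/
lemma IsQuadraticPolynomial.exists_bilinear {ψ : F2 m × F2 d → ZMod 2}
    (hψ : IsQuadraticPolynomial ψ) : ∃ L : F2 m →ₗ[ZMod 2] F2 d, ∀ x y,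
      ψ (x, y) = L x ⬝ᵥ y + ψ (x, 0) + (ψ (0, y) + ψ (0, 0)) := by
  -- This is the mixed second difference of `ψ`; the vanishing of third differences makes it
  -- additive in each variable.
  let β : F2 m → F2 d → ZMod 2 := fun x y => ψ (x, y) + ψ (x, 0) + (ψ (0, y) + ψ (0, 0))
  have h1 : ∀ x x' y, β (x + x') y = β x y + β x' y := fun x x' y => by
    have h := hψ (x, 0) (x', 0) (0, y) (0, 0)
    simp only [fwdDiff, Prod.mk_add_mk, zero_add, add_zero] at h
    simp only [β]
    grind
  have h2 : ∀ x y y', β x (y + y') = β x y + β x y' := fun x y y' => by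
    have h := hψ (x, 0) (0, y) (0, y') (0, 0)
    simp only [fwdDiff, Prod.mk_add_mk, zero_add, add_zero] at h
    simp only [β]
    grind
  choose L hL using fun x => exists_dotProduct
    ((AddMonoidHom.mk' (β x) (h2 x)).toZModLinearMap 2)
  have hL' : ∀ x y, β x y = L x ⬝ᵥ y := hL
  refine ⟨(AddMonoidHom.mk' L fun x x' => dotProduct_eq _ _ fun y => ?_).toZModLinearMap 2,
    fun x y => ?_⟩
  · rw [add_dotProduct, ← hL', ← hL', ← hL', h1]
  · have h3 : ψ (x, y) = β x y + ψ (x, 0) + (ψ (0, y) + ψ (0, 0)) := by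
      simp only [β]; grind
    rw [h3, hL']
    rfl

lemma exists_quadratic_correlating {C : ℝ} (hC : PolynomialInverseU3 C) {K : ℝ} (hK : 2 ≤ K)
    {f : F2 m × F2 d → ℂ} (hf : IsApproxQuadratic K f) :
    ∃ ψ : F2 m × F2 d → ZMod 2, IsQuadraticPolynomial ψ ∧
      K ^ (-C) * (Fintype.card (F2 m) * Fintype.card (F2 d)) ≤
        ‖∑ x, ∑ y, f (x, y) * sgn (ψ (x, y))‖ := by
  let e : F2 (m + d) ≃ₗ[ZMod 2] F2 m × F2 d := LinearEquiv.ofFinrankEq _ _ (by simp)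
  obtain ⟨ψ, hψ, h⟩ := hC K hK (m + d) (fun x => f (e x)) ⟨fun x => hf.1 _, by
    have : gowersU3Average (fun x => f (e x)) = gowersU3Average f :=
      gowersU3Average_comp_addEquiv e.toAddEquiv f
    rw [gowersU3Norm, this]
    exact hf.2⟩
  refine ⟨fun p => ψ (e.symm p), hψ.comp_addMonoidHom e.symm.toAddEquiv.toAddMonoidHom, ?_⟩
  have h1 := correlates_signPhase_iff.1 h
  rw [Fintype.card_congr e.toEquiv, Fintype.card_prod, Nat.cast_mul] at h1
  refine h1.trans (le_of_eq ?_)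
  rw [← Fintype.sum_prod_type']
  congr 1
  exact Fintype.sum_equiv e.toEquiv _ _ fun x => by simp

/-- By Parseval a bounded function has few large Fourier coefficients, so if its coefficients at `θ
a` are large on average over `A`, then `θ` repeats some value often. -/
lemma exists_popular_value {A : Finset (F2 d)} (hA : A.Nonempty) (θ : F2 d → F2 d)
    {g : F2 d → ℂ} (hg : ∀ x, ‖g x‖ ≤ 1) {τ : ℝ} (hτ : 0 ≤ τ)
    (h : τ * (A.card * Fintype.card (F2 d)) ≤ ∑ a ∈ A, ‖hat g (θ a)‖) :
    ∃ ξ, τ ^ 2 * A.card ≤ (A.filter fun a => θ a = ξ).card := by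
  classical
  have hD := card_F2_pos d
  set D : ℝ := (Fintype.card (F2 d) : ℝ)
  have hA0 : (0 : ℝ) < A.card := by exact_mod_cast hA.card_pos
  obtain ⟨ξ, -, hξ⟩ := Finset.exists_max_image Finset.univ
    (fun ξ => (A.filter fun a => θ a = ξ).card) ⟨0, Finset.mem_univ _⟩
  refine ⟨ξ, ?_⟩
  set M := (A.filter fun a => θ a = ξ).card
  have h1 : ∑ a ∈ A, ‖hat g (θ a)‖ ^ 2 ≤ M * (D * D) := by
    rw [← Finset.sum_fiberwise_of_maps_to (g := θ) (t := Finset.univ)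
      (fun _ _ => Finset.mem_univ _)]
    calc _ ≤ ∑ ζ, M * ‖hat g ζ‖ ^ 2 := by
          refine Finset.sum_le_sum fun ζ _ => ?_
          rw [Finset.sum_congr rfl (g := fun _ => ‖hat g ζ‖ ^ 2)
            (fun x hx => by rw [(Finset.mem_filter.1 hx).2]), Finset.sum_const, nsmul_eq_mul]
          exact mul_le_mul_of_nonneg_right (Nat.cast_le.2 (hξ ζ (Finset.mem_univ _)))
            (by positivity)
      _ ≤ _ := by
          rw [← Finset.mul_sum, sum_norm_sq_hat]
          gcongr
          exact sum_norm_sq_le_card hg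
  have h2 := sq_sum_le_card_mul_sum_sq (s := A) (f := fun a => ‖hat g (θ a)‖)
  refine le_of_mul_le_mul_right ?_ (show 0 < A.card * (D * D) by positivity)
  calc τ ^ 2 * A.card * (A.card * (D * D)) = (τ * (A.card * D)) ^ 2 := by ring
    _ ≤ (∑ a ∈ A, ‖hat g (θ a)‖) ^ 2 := by gcongr
    _ ≤ A.card * (M * (D * D)) := h2.trans (by gcongr)
    _ = _ := by ring

/-- A set modelled faithfully by a dense subset of `𝔽₂ᵐ` meets a coset of a small subgroup. -/
lemma exists_coset_of_model {C : ℝ} (hC : PolynomialInverseU3 C) {A : Finset (F2 d)}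
    (hA : A.Nonempty) {K : ℝ} (hK : 2 ≤ K) (π : F2 d →ₗ[ZMod 2] F2 m)
    (hπ : ∀ a ∈ A, ∀ b ∈ A, ∀ c ∈ A, ∀ e ∈ A, π (a + b + c + e) = 0 → a + b + c + e = 0)
    (hcard : (Fintype.card (F2 m) : ℝ) ≤ K * A.card) :
    ∃ (L : F2 m →ₗ[ZMod 2] F2 d) (ξ : F2 d),
      (K ^ (-C)) ^ 2 * A.card ≤ (A.filter fun a => a + L (π a) = ξ).card := by
  classical
  have hK0 : 0 < K := by linarith
  have hE := card_F2_pos m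
  have hD := card_F2_pos d
  have hinj : Set.InjOn π A := by
    intro a ha b hb hab
    have h := hπ a ha b hb a ha a ha (by simp [map_add, hab, ZModModule.add_self])
    rw [add_assoc, ZModModule.add_self, add_zero, ← ZModModule.sub_eq_add, sub_eq_zero] at h
    exact h
  let φ : F2 m → F2 d := Function.invFunOn π A
  have hφ : ∀ a ∈ A, φ (π a) = a := fun a ha => hinj.leftInvOn_invFunOn ha
  set E := A.image π
  have hEcard : E.card = A.card := Finset.card_image_of_injOn hinj
  have hfreiman : ∀ x ∈ E, ∀ y ∈ E, ∀ z ∈ E, ∀ w ∈ E, w = x + y + z →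
      φ w = φ x + φ y + φ z := by
    intro x hx y hy z hz w hw e
    obtain ⟨a, ha, rfl⟩ := Finset.mem_image.1 hx
    obtain ⟨b, hb, rfl⟩ := Finset.mem_image.1 hy
    obtain ⟨c, hc, rfl⟩ := Finset.mem_image.1 hz
    obtain ⟨v, hv, rfl⟩ := Finset.mem_image.1 hw
    rw [hφ a ha, hφ b hb, hφ c hc, hφ v hv]
    have h := hπ a ha b hb c hc v hv (by
      rw [map_add _ _ v, e, map_add, map_add, ZModModule.add_self])
    rw [← ZModModule.sub_eq_add, sub_eq_zero] at h
    exact h.symm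
  -- The `U³` average is that of the indicator of `E`, hence at least the eighth power of its
  -- density, which is at least `1 / K`.
  have happ : IsApproxQuadratic K (freimanPhase E φ) := by
    refine ⟨norm_freimanPhase_le E φ, ?_⟩
    have hmean : 𝔼 x, ind E x = A.card / Fintype.card (F2 m) := by
      rw [Fintype.expect_eq_sum_div_card, ← hEcard]
      simp [ind]
    have h1 : 1 / K ≤ 𝔼 x, ind E x := by
      rw [hmean, div_le_div_iff₀ hK0 hE]
      linarith
    have h2 := expect_pow_eight_le_gowersU3Average (ind E)
    rw [gowersU3Norm, gowersU3Average_freimanPhase hfreiman]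
    calc 1 / K = ((1 / K) ^ 8) ^ (1 / 8 : ℝ) := by
          rw [← Real.rpow_natCast, ← Real.rpow_mul (by positivity)]
          norm_num
      _ ≤ _ := by
          refine Real.rpow_le_rpow (by positivity) (le_trans ?_ h2) (by norm_num)
          gcongr
  obtain ⟨ψ, hψ, hcor⟩ := exists_quadratic_correlating hC hK happ
  obtain ⟨L, hL⟩ := hψ.exists_bilinear
  refine ⟨L, exists_popular_value hA (fun a => a + L (π a))
    (g := fun y => sgn (ψ (0, y) + ψ (0, 0))) (by simp) (by positivity) ?_⟩
  -- For `x = π a`, the phase `a · y` merges with the bilinear part of `ψ`; the sum over `y` is a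
  -- Fourier coefficient at `a + L (π a)` of a function not depending on `a`.
  have hsum : ∑ x, ∑ y, freimanPhase E φ (x, y) * sgn (ψ (x, y)) =
      ∑ a ∈ A, sgn (ψ (π a, 0)) * hat (fun y => sgn (ψ (0, y) + ψ (0, 0))) (a + L (π a)) := by
    rw [← Finset.sum_subset (Finset.subset_univ E), Finset.sum_image hinj]
    · refine Finset.sum_congr rfl fun a ha => ?_
      rw [hat, Finset.mul_sum]
      refine Finset.sum_congr rfl fun y _ => ?_
      simp only [freimanPhase, if_pos (Finset.mem_image_of_mem π ha), hφ a ha, E]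
      rw [hL (π a) y, add_dotProduct]
      simp only [sgn_add]
      ring
    · intro x _ hx
      simp [freimanPhase, hx]
  rw [hsum] at hcor
  have hAm : (A.card : ℝ) ≤ Fintype.card (F2 m) := by
    rw [← hEcard]
    exact_mod_cast Finset.card_le_univ E
  calc _ ≤ K ^ (-C) * (Fintype.card (F2 m) * Fintype.card (F2 d)) := by gcongr
    _ ≤ _ := hcor
    _ ≤ _ := norm_sum_le _ _
    _ = _ := by simp

end Product

/-! ### The inverse theorem implies Freiman–Ruzsa. -/

/-- The subgroup is the range of `L`, no larger than the model group, which has at most `|4A| ≤ K ^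
4 * |A|` elements. This is also why the inverse theorem is invoked with `K ^ 4`. On the popular part
`A'` one has `a = ξ + L (π a)`, so `A' - A'` lies in the range, and Ruzsa covering extends this to
all of `A`. -/
lemma exists_subgroup_covering {C : ℝ} (hC : PolynomialInverseU3 C) {d : ℕ} {A : Finset (F2 d)}
    (hA : A.Nonempty) {K : ℝ} (hK : 2 ≤ K) (hAA : ((A + A).card : ℝ) ≤ K * A.card) :
    ∃ (H : Submodule (ZMod 2) (F2 d)) (X : Finset (F2 d)),
      (Nat.card H : ℝ) ≤ K ^ 4 * A.card ∧ (X.card : ℝ) ≤ K * ((K ^ 4) ^ C) ^ 2 ∧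
      ∀ a ∈ A, ∃ x ∈ X, a - x ∈ H := by
  classical
  have hK0 : 0 < K := by linarith
  have hA0 : (0 : ℝ) < A.card := by exact_mod_cast hA.card_pos
  obtain ⟨a₀, ha₀⟩ := hA
  have hT0 : (0 : F2 d) ∈ 4 • A := by
    rw [show 4 • A = A + A + A + A by abel]
    have := Finset.add_mem_add (Finset.add_mem_add (Finset.add_mem_add ha₀ ha₀) ha₀) ha₀
    rwa [ZModModule.add_self, zero_add, ZModModule.add_self] at this
  obtain ⟨m, π, hm, hπ⟩ := exists_small_model hT0
  have hm4 : (Fintype.card (F2 m) : ℝ) ≤ K ^ 4 * A.card := by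
    have h4 := Finset.pluennecke_ruzsa_inequality_nsmul_add ⟨a₀, ha₀⟩ A 4
    have h6 : (((A + A).card / A.card : NNRat) : ℝ) ≤ K := by
      push_cast
      rwa [div_le_iff₀ hA0]
    have h7 : ((4 • A).card : ℝ) ≤ ((((A + A).card / A.card : NNRat) : ℝ)) ^ 4 * A.card := by
      exact_mod_cast h4
    exact (Nat.cast_le.2 hm).trans (h7.trans (by gcongr))
  obtain ⟨L, ξ, hpop⟩ := exists_coset_of_model hC ⟨a₀, ha₀⟩
    (hK.trans (le_self_pow₀ (by linarith) (by norm_num : 4 ≠ 0))) π (fun a ha b hb c hc e he h => by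
      refine hπ _ ?_ h
      rw [show 4 • A = A + A + A + A by abel]
      exact Finset.add_mem_add (Finset.add_mem_add (Finset.add_mem_add ha hb) hc) he) hm4
  set A' := A.filter fun a => a + L (π a) = ξ
  set P : ℝ := ((K ^ 4) ^ C) ^ 2
  have hP : 0 < P := by positivity
  have hpop' : (A.card : ℝ) ≤ P * A'.card := by
    rw [Real.rpow_neg (by positivity), inv_pow, inv_mul_le_iff₀ hP] at hpop
    exact hpop
  have hA' : A'.Nonempty := by
    rw [← Finset.card_pos]
    exact_mod_cast (pos_of_mul_pos_right (hA0.trans_le hpop') hP.le)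
  obtain ⟨X, -, hX, hcov⟩ := Finset.ruzsa_covering_add (K := K * P) hA' (A := A) (by
    calc ((A + A').card : ℝ) ≤ (A + A).card := by
          exact_mod_cast Finset.card_le_card (Finset.add_subset_add_left (Finset.filter_subset _ _))
      _ ≤ K * (P * A'.card) := hAA.trans (by gcongr)
      _ = _ := by ring)
  refine ⟨LinearMap.range L, X, ?_, hX, fun a ha => ?_⟩
  · refine le_trans ?_ hm4
    rw [← Nat.card_eq_fintype_card]
    exact_mod_cast Nat.card_le_card_of_surjective _ L.surjective_rangeRestrict
  · obtain ⟨x, hx, u, hu, rfl⟩ := Finset.mem_add.1 (hcov ha)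
    refine ⟨x, hx, ?_⟩
    obtain ⟨b, hb, c, hc, rfl⟩ := Finset.mem_sub.1 hu
    have h1 : ∀ b ∈ A', b = ξ + L (π b) := fun b hb => by
      rw [← (Finset.mem_filter.1 hb).2, add_assoc, ZModModule.add_self, add_zero]
    rw [add_sub_cancel_left, h1 b hb, h1 c hc, add_sub_add_left_eq_sub, ← map_sub]
    exact LinearMap.mem_range_self L _

lemma exists_finset_preimage {A : Set (ℕ →₀ ZMod 2)} (hA : A.Finite) :
    ∃ (d : ℕ) (j : F2 d →ₗ[ZMod 2] (ℕ →₀ ZMod 2)) (A₀ : Finset (F2 d)),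
      Function.Injective j ∧ A = j '' (A₀ : Set (F2 d)) := by
  classical
  have : Module.Finite (ZMod 2) (Submodule.span (ZMod 2) A) := Module.Finite.span_of_finite _ hA
  let b := Module.finBasis (ZMod 2) (Submodule.span (ZMod 2) A)
  let j : F2 _ →ₗ[ZMod 2] (ℕ →₀ ZMod 2) :=
    (Submodule.span (ZMod 2) A).subtype ∘ₗ b.equivFun.symm.toLinearMap
  have hj : Function.Injective j := Subtype.val_injective.comp b.equivFun.symm.injective
  refine ⟨_, j, (hA.preimage hj.injOn).toFinset, hj, ?_⟩
  rw [Set.Finite.coe_toFinset, Set.image_preimage_eq_of_subset]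
  intro a ha
  exact ⟨b.equivFun ⟨a, Submodule.subset_span ha⟩, by simp [j]⟩

/-- The subgroup costs `K ^ 4` and the covering set `K ^ (1 + 8 * C)`; the exponent `5 + 8 * C`
dominates both. -/
theorem polynomialFreimanRuzsa_of_polynomialInverseU3 {C : ℝ} (hC0 : 0 < C)
    (hC : PolynomialInverseU3 C) : PolynomialFreimanRuzsa (5 + 8 * C) := by
  classical
  intro K hK A hA
  have hK1 : 1 ≤ K := by linarith
  have hK0 : 0 < K := by linarith
  obtain ⟨d, j, A₀, hj, rfl⟩ := exists_finset_preimage hA.finite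
  have hA₀ : A₀.Nonempty := by simpa using hA.nonempty
  have hAA : ((A₀ + A₀).card : ℝ) ≤ K * A₀.card := by
    obtain ⟨X, hX, hcov⟩ := hA.covered
    have h1 : (A₀ + A₀).image j ⊆ X + A₀.image j := by
      rw [← Finset.coe_subset]
      simp only [Finset.coe_image, Finset.coe_add, Set.image_add]
      exact hcov
    have h2 := (Finset.card_le_card h1).trans Finset.card_add_le
    rw [Finset.card_image_of_injective _ hj, Finset.card_image_of_injective _ hj] at h2
    calc ((A₀ + A₀).card : ℝ) ≤ X.card * A₀.card := by exact_mod_cast h2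
      _ ≤ _ := by gcongr
  obtain ⟨H, X, hH, hX, hcov⟩ := exists_subgroup_covering hC hA₀ hK hAA
  have hcoe : ((H.map j).toAddSubgroup : Set (ℕ →₀ ZMod 2)) = j '' (H : Set (F2 d)) := by
    simp
  have hfin : ((H.map j).toAddSubgroup : Set (ℕ →₀ ZMod 2)).Finite := by
    rw [hcoe]
    exact (Set.toFinite _).image _
  refine ⟨(H.map j).toAddSubgroup, hfin, hA.finite, hfin, ?_, X.image j, ?_, ?_⟩
  · rw [hcoe, Set.ncard_image_of_injective _ hj, Set.ncard_image_of_injective _ hj,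
      Set.ncard_coe_finset]
    refine (show _ ≤ _ from hH).trans ?_
    gcongr
    rw [← Real.rpow_natCast]
    exact Real.rpow_le_rpow_of_exponent_le hK1 (by push_cast; linarith)
  · rw [Finset.card_image_of_injective _ hj]
    refine hX.trans ?_
    rw [← Real.rpow_natCast K 4, ← Real.rpow_natCast _ 2, ← Real.rpow_mul hK0.le,
      ← Real.rpow_mul hK0.le]
    nth_rewrite 1 [← Real.rpow_one K]
    rw [← Real.rpow_add hK0]
    refine Real.rpow_le_rpow_of_exponent_le hK1 ?_
    push_cast
    linarith
  · rintro _ ⟨a, ha, rfl⟩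
    obtain ⟨x, hx, h⟩ := hcov a ha
    refine Set.mem_add.2 ⟨j (a - x), ?_, j x, ?_, ?_⟩
    · rw [hcoe]
      exact ⟨_, h, rfl⟩
    · exact_mod_cast Finset.mem_image_of_mem j hx
    · rw [← map_add, sub_add_cancel]

theorem theorem1p11 :
    (∃ C : ℝ, 0 < C ∧ ∀ K : ℝ, 2 ≤ K → ∀ A : Set (ℕ →₀ ZMod 2), IsApproxGroup K A →
      ∃ H : AddSubgroup (ℕ →₀ ZMod 2), (H : Set (ℕ →₀ ZMod 2)).Finite ∧
        Controls (K ^ C) (H : Set (ℕ →₀ ZMod 2)) A)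
    ↔
    (∃ C : ℝ, 0 < C ∧ ∀ K : ℝ, 2 ≤ K → ∀ (n : ℕ) (f : (Fin n → ZMod 2) → ℂ),
      IsApproxQuadratic K f →
        ∃ ψ : (Fin n → ZMod 2) → ZMod 2, IsQuadraticPolynomial ψ ∧
          Correlates (K ^ (-C)) f (signPhase ψ)) := by
  constructor
  · rintro ⟨C, -, hC⟩
    exact polynomialInverseU3_of_polynomialFreimanRuzsa hC
  · rintro ⟨C, hC0, hC⟩
    exact ⟨5 + 8 * C, by positivity, polynomialFreimanRuzsa_of_polynomialInverseU3 hC0 hC⟩
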